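/- Let $\alpha\in[0,1)$ and set $$\nu_\alpha=\frac{1-\alpha}{2-\alpha},\qquad \kappa_\alpha=\frac{2-\alpha}{2}.$$ For real $\nu>-1$ and $y>0$ let $J_\nu(y)=\sum_{m\ge 0}\frac{(-1)^m}{m!\,\Gamma(m+\nu+1)}\left(\frac y2\right)^{2m+\nu}$ be the Bessel function of the first kind. For $\nu\in\{\nu_\alpha,-\nu_\alpha\}$ the positive zeros of $J_\nu$ form a strictly increasing infinite sequence $0<j_{\nu,1}<j_{\nu,2}<\cdots$. Let $H^1_\alpha(-1,1)$ be the space of real functions $u\in L^2(-1,1)$ that are absolutely continuous on $[-1,1]$ and satisfy $\int_{-1}^1|x|^\alpha u'(x)^2\,dx<\infty$ and $u(-1)=0=u(1)$. Let $H^2_\alpha(-1,1)$ be the space of $u\in H^1_\alpha(-1,1)$ such that $|x|^\alpha u'$ has its derivative in $L^2(-1,1)$, i.e. agrees almost everywhere with an absolutely continuous function on $[-1,1]$ whose derivative is square integrable. Consider the eigenvalue problem $$-(|x|^\alpha\Phi')'=\lambda\Phi\ \text{ on }(-1,1),\qquad \Phi(-1)=0=\Phi(1),\qquad \Phi\in H^2_\alpha(-1,1),\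 \lambda\in\mathbb R;$$ $\lambda$ is an eigenvalue if there is a solution $\Phi\neq 0$. For $n\ge 1$ put $$\Phi^{(o)}_{\alpha,n}(x)=\begin{cases}x^{\frac{1-\alpha}2}J_{\nu_\alpha}(j_{\nu_\alpha,n}x^{\kappa_\alpha}),&x\in(0,1),\\ -|x|^{\frac{1-\alpha}2}J_{\nu_\alpha}(j_{\nu_\alpha,n}|x|^{\kappa_\alpha}),&x\in(-1,0),\end{cases}$$ $$\Phi^{(e)}_{\alpha,n}(x)=|x|^{\frac{1-\alpha}2}J_{-\nu_\alpha}(j_{-\nu_\alpha,n}|x|^{\kappa_\alpha}),\quad x\in(-1,0)\cup(0,1).$$ Functions are identified when they agree almost everywhere. Then: 1. The eigenvalues are exactly the numbers $\kappa_\alpha^2j_{\nu_\alpha,n}^2$ and $\kappa_\alpha^2j_{-\nu_\alpha,n}^2$, $n\ge1$. 2. For every $n\ge1$, the function $\Phi^{(o)}_{\alpha,n}$ is odd, and the solutions of the problem with $\lambda=\kappa_\alpha^2j_{\nu_\alpha,n}^2$ are exactly its real multiples. 3. For every $n\ge1$, the function $\Phi^{(e)}_{\alpha,n}$ is even, and the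 solutions of the problem with $\lambda=\kappa_\alpha^2j_{-\nu_\alpha,n}^2$ are exactly its real multiples. 4. The family $\{\Phi^{(o)}_{\alpha,n},\Phi^{(e)}_{\alpha,n}: n\ge1\}$ is an orthogonal basis of $L^2(-1,1)$, i.e. its members are nonzero, pairwise orthogonal, and their linear span is dense. -/

import Mathlib

open MeasureTheory Set Filter

noncomputable section

/-- The Bessel function of the first kind of real order `ν`, for positive arguments `y`:
`J_ν(y) = ∑_m (-1)^m / (m! Γ(m + ν + 1)) (y/2)^(2m + ν)`. -/
def besselJ (ν y : ℝ) : ℝ :=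
  ∑' m : ℕ, (-1 : ℝ) ^ m / ((m.factorial : ℝ) * Real.Gamma ((m : ℝ) + ν + 1)) *
    (y / 2) ^ (2 * (m : ℝ) + ν)

/-- The set of positive zeros of `J_ν`. -/
def besselZeroSet (ν : ℝ) : Set ℝ := {y | 0 < y ∧ besselJ ν y = 0}

/-- `besselZero ν n` is, for `n ≥ 1`, the `n`-th positive zero `j_{ν,n}` of `J_ν`: starting from
`0`, each term is the smallest positive zero beyond the previous term. -/
def besselZero (ν : ℝ) : ℕ → ℝ
  | 0 => 0
  | n + 1 => sInf {y | besselZero ν n < y ∧ y ∈ besselZeroSet ν}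

/-- `ν_α = |α - 1| / (2 - α)`. -/
def nuAlpha (α : ℝ) : ℝ := |α - 1| / (2 - α)

/-- `κ_α = (2 - α) / 2`. -/
def kappaAlpha (α : ℝ) : ℝ := (2 - α) / 2

/-- The odd functions `Φ^{(o)}_{α,n}`; the value at the single point `0` plays no role, since
these functions are only used up to null sets. -/
def oddPhi (α : ℝ) (n : ℕ) (x : ℝ) : ℝ :=
  if 0 < x then
    x ^ ((1 - α) / 2) *
      besselJ (nuAlpha α) (besselZero (nuAlpha α) n * x ^ kappaAlpha α)
  else if x < 0 then
    -(|x| ^ ((1 - α) / 2) *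
      besselJ (nuAlpha α) (besselZero (nuAlpha α) n * |x| ^ kappaAlpha α))
  else 0

/-- The even functions `Φ^{(e)}_{α,n}`; the value at the single point `0` plays no role, since
these functions are only used up to null sets. -/
def evenPhi (α : ℝ) (n : ℕ) (x : ℝ) : ℝ :=
  if 0 < x then
    x ^ ((1 - α) / 2) *
      besselJ (-nuAlpha α) (besselZero (-nuAlpha α) n * x ^ kappaAlpha α)
  else if x < 0 then
    |x| ^ ((1 - α) / 2) *
      besselJ (-nuAlpha α) (besselZero (-nuAlpha α) n * |x| ^ kappaAlpha α)
  else 0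

/-- Lebesgue measure on `(-1, 1)`. -/
abbrev muI : Measure ℝ := volume.restrict (Ioo (-1 : ℝ) 1)

/-- The real Hilbert space `L²(-1, 1)`. -/
abbrev L2I : Type := Lp ℝ 2 muI

/-- The space `H¹_α(-1, 1)` for `α ∈ [0, 1)`: absolutely continuous functions on `[-1, 1]`,
vanishing at both end points, with `∫ |x|^α u'(x)² dx < ∞`. -/
structure MemH1 (α : ℝ) (u : ℝ → ℝ) : Prop where
  memLp : MemLp u 2 muI
  absCont : AbsolutelyContinuousOnInterval u (-1) 1
  energy : Integrable (fun x => |x| ^ α * deriv u x ^ 2) muI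
  left : u (-1) = 0
  right : u 1 = 0

/-- The flux `x ↦ |x|^α u'(x)`. -/
def flux (α : ℝ) (u : ℝ → ℝ) (x : ℝ) : ℝ := |x| ^ α * deriv u x

/-- The space `H²_α(-1, 1)`: functions in `H¹_α(-1, 1)` whose flux `|x|^α u'` has its
(distributional) derivative in `L²(-1, 1)`, that is, agrees almost everywhere with an absolutely
continuous function on `[-1, 1]` whose derivative is square integrable. -/
structure MemH2 (α : ℝ) (u : ℝ → ℝ) : Prop extends MemH1 α u where
  flux_absCont : ∃ w : ℝ → ℝ, AbsolutelyContinuousOnInterval w (-1) 1 ∧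
    w =ᵐ[muI] flux α u ∧ MemLp (deriv w) 2 muI

/-- The operator `A u = (|x|^α u')'`, with domain `H²_α(-1, 1)`. On that domain the flux is, away
from `0`, equal to its absolutely continuous representative, so the pointwise derivative is the
distributional one. -/
def degOp (α : ℝ) (u : ℝ → ℝ) : ℝ → ℝ := deriv (flux α u)

/-- The set of all (possibly zero) solutions `Φ ∈ L²(-1, 1)` of `-(|x|^α Φ')' = lam Φ` on
`(-1, 1)`, `Φ(-1) = 0 = Φ(1)`: the classes of `u ∈ H²_α(-1, 1)` with `-A u = lam u`. -/
def eigenSet (α lam : ℝ) : Set L2I :=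
  {f | ∃ u : ℝ → ℝ, MemH2 α u ∧ f =ᵐ[muI] u ∧ ∀ᵐ x ∂muI, -degOp α u x = lam * u x}

/-- `lam` is an eigenvalue if the problem has a nontrivial solution. -/
def IsEigenvalue (α lam : ℝ) : Prop := ∃ f ∈ eigenSet α lam, f ≠ 0

/-- An orthogonal basis of a Hilbert space: nonzero, pairwise orthogonal vectors with dense
linear span. -/
def IsOrthogonalBasis {ι H : Type*} [NormedAddCommGroup H] [InnerProductSpace ℝ H]
    (v : ι → H) : Prop :=
  (∀ i, v i ≠ 0) ∧ (∀ i k, i ≠ k → inner ℝ (v i) (v k) = 0) ∧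
    (Submodule.span ℝ (range v)).topologicalClosure = ⊤

end

/-!
The substitution `z = λ |x|^(2-α) / (2-α)²` turns the equation `-(|x|^α u')' = λ u` into the
Bessel equation, stripped of its fractional powers: with the entire functions `F_ν(z) = ∑ (-1)^m /
(m! Γ(m+ν+1)) z^m`, for which `J_ν(y) = (y/2)^ν F_ν((y/2)²)`, one even and one odd solution are
`F_{-ν_α}(z)` and `sgn(x) |x|^(1-α) F_{ν_α}(z)`, and their fluxes `|x|^α u'` are given by
`F_{1-ν_α}` and `F_{ν_α-1}`.

A solution in `H²_α` is a pair `(u, w)` of absolutely continuous functions with `u' = |x|^(-α) w`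
and `w' = -λ u` almost everywhere (`IsFluxPair`, `mem_eigenSet_iff`); the continuity of both `u`
and `w` at the origin is the transmission condition there. The Wronskian of two such pairs is
constant, and therefore every solution is a combination of the even and the odd one
(`IsFluxPair.exists_eq_evenSol_add_oddSol`). The boundary conditions separate the two parities, so
that `λ` is an eigenvalue if and only if `F_{ν_α}` or `F_{-ν_α}` vanishes at `λ / (2-α)²`. A
Wronskian identity between the functions `F_ν` (`besselEntire_wronskian`) shows that this does not
happen for both at once, so the eigenspaces are lines, and that the zeros of `F_{±ν_α}` are
simple, hence isolated. As `ν_α ≤ 1/2`, Sturm comparison with the sine shows that there are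
infinitely many of them (`not_forall_pos_besselEntire_sq`).

Eigenfunctions of distinct eigenvalues are orthogonal by Green's identity
(`IsFluxPair.integral_mul_eq`). Since `|x|^(-α)` is integrable, the problem with a right hand side
in `L²(-1, 1)` is solved by two integrations; the solution operator is injective, symmetric by
Green's identity and compact by the theorem of Arzelà and Ascoli, and the spectral theorem gives
completeness (`topologicalClosure_eq_top_of_eigenSet_subset`).
-/

open scoped Topology

/-! ### The entire function behind `J_ν` -/

/-- The coefficients `(-1)^m / (m! Γ(m + ν + 1))` of the entire function `besselEntire ν`. -/
noncomputable def besselCoeff (ν : ℝ) (m : ℕ) : ℝ :=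
  (-1 : ℝ) ^ m / ((m.factorial : ℝ) * Real.Gamma ((m : ℝ) + ν + 1))

/-- The entire function `F_ν(z) = ∑ (-1)^m / (m! Γ(m + ν + 1)) z^m`, so that
`J_ν(y) = (y/2)^ν F_ν((y/2)²)` for `y > 0`. -/
noncomputable def besselEntire (ν z : ℝ) : ℝ := ∑' m : ℕ, besselCoeff ν m * z ^ m

/-- The series of `besselEntire ν` is dominated by a multiple of the exponential series. -/
lemma exists_abs_besselCoeff_le {ν : ℝ} (hν : -1 < ν) :
    ∃ C, 0 ≤ C ∧ ∀ m : ℕ, |besselCoeff ν m| ≤ C / (m.factorial : ℝ) := by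
  have h0 : 0 < Real.Gamma (ν + 1) := Real.Gamma_pos_of_pos (by linarith)
  have h1 : 0 < Real.Gamma (ν + 2) := Real.Gamma_pos_of_pos (by linarith)
  -- from `m = 1` on, `Γ(m + ν + 1)` increases, because `m + ν + 1 ≥ 1`
  have key : ∀ m : ℕ, Real.Gamma (ν + 2) ≤ Real.Gamma ((m : ℝ) + ν + 2) := by
    intro m
    induction m with
    | zero => simp
    | succ k ih =>
      have hk : (0 : ℝ) ≤ k := Nat.cast_nonneg k
      have e : (((k + 1 : ℕ) : ℝ) + ν + 2) = ((k : ℝ) + ν + 2) + 1 := by push_cast; ring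
      rw [e, Real.Gamma_add_one (by linarith)]
      nlinarith
  refine ⟨(Real.Gamma (ν + 1))⁻¹ + (Real.Gamma (ν + 2))⁻¹, by positivity, fun m => ?_⟩
  have hm : 0 < Real.Gamma ((m : ℝ) + ν + 1) :=
    Real.Gamma_pos_of_pos (by have : (0 : ℝ) ≤ m := Nat.cast_nonneg m; linarith)
  have hf : 0 < (m.factorial : ℝ) := by exact_mod_cast m.factorial_pos
  have hb : (Real.Gamma ((m : ℝ) + ν + 1))⁻¹ ≤
      (Real.Gamma (ν + 1))⁻¹ + (Real.Gamma (ν + 2))⁻¹ := by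
    cases m with
    | zero => simpa using h1.le
    | succ k =>
      have := inv_anti₀ h1 (key k)
      have e : (((k + 1 : ℕ) : ℝ) + ν + 1) = (k : ℝ) + ν + 2 := by push_cast; ring
      rw [e]
      have := inv_pos.2 h0
      linarith
  rw [besselCoeff, abs_div, abs_pow, abs_neg, abs_one, one_pow, abs_of_pos (by positivity),
    one_div, mul_inv, mul_comm, ← div_eq_mul_inv]
  gcongr

lemma summable_besselCoeff {ν : ℝ} (hν : -1 < ν) (z : ℝ) :
    Summable fun m : ℕ => besselCoeff ν m * z ^ m := by
  obtain ⟨C, -, hC⟩ := exists_abs_besselCoeff_le hν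
  refine Summable.of_norm_bounded ((Real.summable_pow_div_factorial |z|).mul_left C) fun m => ?_
  rw [Real.norm_eq_abs, abs_mul, abs_pow]
  calc _ ≤ C / (m.factorial : ℝ) * |z| ^ m := by gcongr; exact hC m
    _ = _ := by ring

lemma besselCoeff_succ (ν : ℝ) (m : ℕ) :
    besselCoeff ν (m + 1) * ((m + 1 : ℕ) : ℝ) = -besselCoeff (ν + 1) m := by
  have hm : ((m : ℝ) + 1) ≠ 0 := by positivity
  have e : (((m + 1 : ℕ) : ℝ) + ν + 1) = (m : ℝ) + (ν + 1) + 1 := by push_cast; ring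
  rw [besselCoeff, besselCoeff, e, Nat.factorial_succ, pow_succ]
  push_cast
  field_simp

lemma besselCoeff_pred {μ : ℝ} (hμ : 0 < μ) (m : ℕ) :
    (μ + m) * besselCoeff μ m = besselCoeff (μ - 1) m := by
  have hm : (m : ℝ) + μ ≠ 0 := by positivity
  have e : (m : ℝ) + (μ - 1) + 1 = (m : ℝ) + μ := by ring
  rw [besselCoeff, besselCoeff, e, Real.Gamma_add_one hm, add_comm μ]
  field_simp

/-- `F_ν' = -F_{ν+1}`. -/
lemma hasDerivAt_besselEntire {ν : ℝ} (hν : -1 < ν) (z : ℝ) :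
    HasDerivAt (besselEntire ν) (-besselEntire (ν + 1) z) z := by
  obtain ⟨C, hC0, hC⟩ := exists_abs_besselCoeff_le hν
  set R := |z| + 1 with hR
  have hR0 : 0 ≤ R := by positivity
  have hu : Summable fun m : ℕ => C / (m.factorial : ℝ) * (m * R ^ (m - 1)) := by
    rw [← summable_nat_add_iff 1]
    refine ((Real.summable_pow_div_factorial R).mul_left C).congr fun m => ?_
    have : ((m : ℝ) + 1) ≠ 0 := by positivity
    rw [Nat.factorial_succ]
    push_cast [Nat.add_sub_cancel]
    field_simp
  have h := hasDerivAt_tsum_of_isPreconnected (t := Metric.ball (0 : ℝ) R)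
    (g := fun (m : ℕ) (y : ℝ) => besselCoeff ν m * y ^ m)
    (g' := fun (m : ℕ) (y : ℝ) => besselCoeff ν m * (m * y ^ (m - 1))) (y₀ := 0) (y := z) hu
    Metric.isOpen_ball (convex_ball _ _).isPreconnected
    (fun m y _ => (hasDerivAt_pow m y).const_mul _)
    (fun m y hy => by
      have hy' : |y| ≤ R := by simpa using (Metric.mem_ball.1 hy).le
      rw [Real.norm_eq_abs, abs_mul, abs_mul, abs_pow, Nat.abs_cast]
      gcongr
      exact hC m)
    (Metric.mem_ball_self (by positivity)) (summable_besselCoeff hν 0)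
    (by simp [hR])
  refine HasDerivAt.congr_deriv (f := besselEntire ν) h ?_
  have hs : Summable fun m : ℕ => besselCoeff ν m * (m * z ^ (m - 1)) := by
    refine Summable.of_norm_bounded hu fun m => ?_
    rw [Real.norm_eq_abs, abs_mul, abs_mul, abs_pow, Nat.abs_cast]
    gcongr
    · exact hC m
    · linarith
  rw [hs.tsum_eq_zero_add, besselEntire, ← tsum_neg]
  simp only [Nat.cast_zero, zero_mul, mul_zero, zero_add, Nat.add_sub_cancel]
  refine tsum_congr fun m => ?_
  rw [← mul_assoc, besselCoeff_succ, neg_mul]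

lemma continuous_besselEntire {ν : ℝ} (hν : -1 < ν) : Continuous (besselEntire ν) :=
  continuous_iff_continuousAt.2 fun z => (hasDerivAt_besselEntire hν z).continuousAt

/-- The recurrence `μ F_μ - z F_{μ+1} = F_{μ-1}`. -/
lemma besselEntire_recurrence {μ : ℝ} (hμ : 0 < μ) (z : ℝ) :
    μ * besselEntire μ z - z * besselEntire (μ + 1) z = besselEntire (μ - 1) z := by
  have h1 := summable_besselCoeff (ν := μ) (by linarith) z
  have h2 := summable_besselCoeff (ν := μ + 1) (by linarith) z
  have h3 : HasSum (fun m : ℕ => (m : ℝ) * besselCoeff μ m * z ^ m)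
      (-(z * besselEntire (μ + 1) z)) := by
    rw [← hasSum_nat_add_iff' 1]
    have := (h2.hasSum.mul_left z).neg
    simp only [Finset.range_one, Finset.sum_singleton, Nat.cast_zero, zero_mul, sub_zero]
    refine this.congr_fun fun m => ?_
    have e := besselCoeff_succ μ m
    rw [mul_comm (((m + 1 : ℕ) : ℝ)), e]
    ring
  have h4 := (h1.hasSum.mul_left μ).add h3
  rw [besselEntire, besselEntire, sub_eq_add_neg] at *
  rw [← h4.tsum_eq]
  refine tsum_congr fun m => ?_
  rw [← besselCoeff_pred hμ]
  ring

lemma besselEntire_zero (ν : ℝ) : besselEntire ν 0 = (Real.Gamma (ν + 1))⁻¹ := by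
  rw [besselEntire, tsum_eq_single 0 (fun m hm => by simp [hm])]
  simp [besselCoeff]

lemma besselEntire_pos_of_nonpos {ν z : ℝ} (hν : -1 < ν) (hz : z ≤ 0) :
    0 < besselEntire ν z := by
  have hterm : ∀ m : ℕ, 0 ≤ besselCoeff ν m * z ^ m := by
    intro m
    have hm : 0 < Real.Gamma ((m : ℝ) + ν + 1) :=
      Real.Gamma_pos_of_pos (by have : (0 : ℝ) ≤ m := Nat.cast_nonneg m; linarith)
    have e : besselCoeff ν m * z ^ m =
        (-z) ^ m / ((m.factorial : ℝ) * Real.Gamma ((m : ℝ) + ν + 1)) := by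
      rw [besselCoeff, neg_pow z]; ring
    rw [e]
    have : 0 ≤ (-z) ^ m := pow_nonneg (by linarith) m
    positivity
  refine (summable_besselCoeff hν z).tsum_pos hterm 0 ?_
  have : 0 < Real.Gamma (ν + 1) := Real.Gamma_pos_of_pos (by linarith)
  simpa [besselCoeff] using this

lemma besselJ_eq {ν y : ℝ} (hy : 0 < y) :
    besselJ ν y = (y / 2) ^ ν * besselEntire ν ((y / 2) ^ 2) := by
  rw [besselJ, besselEntire, ← tsum_mul_left]
  refine tsum_congr fun m => ?_
  have h2 : (0 : ℝ) < y / 2 := by positivity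
  have e : (y / 2) ^ (2 * (m : ℝ) + ν) = (y / 2) ^ ν * ((y / 2) ^ 2) ^ m := by
    rw [Real.rpow_add h2, ← pow_mul, mul_comm]
    congr 1
    rw [← Real.rpow_natCast]
    push_cast
    rfl
  rw [e, besselCoeff]
  ring

/-- The Wronskian of the two solutions of the Bessel equation of order `ν`, in terms of the
entire functions. -/
lemma besselEntire_wronskian {ν : ℝ} (h0 : 0 < ν) (h1 : ν < 1) (z : ℝ) :
    besselEntire (-ν) z * besselEntire (ν - 1) z +
      z * (besselEntire (1 - ν) z * besselEntire ν z) =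
      (Real.Gamma (1 - ν) * Real.Gamma ν)⁻¹ := by
  have hd : ∀ z, HasDerivAt (fun z => besselEntire (-ν) z * besselEntire (ν - 1) z +
      z * (besselEntire (1 - ν) z * besselEntire ν z)) 0 z := by
    intro z
    have a := hasDerivAt_besselEntire (ν := -ν) (by linarith) z
    have b := hasDerivAt_besselEntire (ν := ν - 1) (by linarith) z
    have c := hasDerivAt_besselEntire (ν := 1 - ν) (by linarith) z
    have d := hasDerivAt_besselEntire (ν := ν) (by linarith) z
    refine ((a.mul b).add ((hasDerivAt_id z).mul (c.mul d))).congr_deriv ?_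
    have r1 := besselEntire_recurrence (μ := ν) h0 z
    have r2 := besselEntire_recurrence (μ := 1 - ν) (by linarith) z
    have e1 : -ν + 1 = 1 - ν := by ring
    have e2 : ν - 1 + 1 = ν := by ring
    have e3 : 1 - ν - 1 = -ν := by ring
    rw [e3] at r2
    rw [e1, e2, ← r1, ← r2]
    simp only [id, Pi.mul_apply]
    ring
  have hc := is_const_of_deriv_eq_zero (fun z => (hd z).differentiableAt)
    (fun z => (hd z).deriv) z 0
  have e1 : -ν + 1 = 1 - ν := by ring
  have e2 : ν - 1 + 1 = ν := by ring
  rw [hc]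
  simp only [besselEntire_zero, zero_mul, add_zero, e1, e2, mul_inv]

lemma besselEntire_wronskian_pos {ν : ℝ} (h0 : 0 < ν) (h1 : ν < 1) :
    0 < (Real.Gamma (1 - ν) * Real.Gamma ν)⁻¹ :=
  inv_pos.2 (mul_pos (Real.Gamma_pos_of_pos (by linarith)) (Real.Gamma_pos_of_pos h0))

/-- `F_ν` and `F_{-ν}` have no common zero. -/
lemma besselEntire_neg_ne_zero {ν z : ℝ} (h0 : 0 < ν) (h1 : ν < 1) (hz : besselEntire ν z = 0) :
    besselEntire (-ν) z ≠ 0 := by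
  intro h
  have := besselEntire_wronskian h0 h1 z
  rw [h, hz] at this
  simp only [mul_zero, zero_mul, add_zero] at this
  exact (besselEntire_wronskian_pos h0 h1).ne this

/-- The zeros of `F_ν` are simple. -/
lemma besselEntire_add_one_ne_zero {ν z : ℝ} (hν : ν ∈ Ioo (-1 : ℝ) 1) (hν0 : ν ≠ 0)
    (hz : besselEntire ν z = 0) : besselEntire (ν + 1) z ≠ 0 := by
  intro h
  rcases lt_or_gt_of_ne hν0 with hneg | hpos
  · have := besselEntire_wronskian (ν := -ν) (by linarith) (by linarith [hν.1]) z
    rw [neg_neg, hz, sub_neg_eq_add, add_comm (1 : ℝ), h] at this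
    simp only [mul_zero, zero_mul, add_zero] at this
    have h2 := besselEntire_wronskian_pos (ν := -ν) (by linarith) (by linarith [hν.1])
    rw [sub_neg_eq_add, add_comm (1 : ℝ)] at h2
    exact h2.ne this
  · have := besselEntire_wronskian hpos hν.2 z
    have r := besselEntire_recurrence hpos z
    rw [h, hz] at r
    rw [hz, ← r] at this
    simp only [mul_zero, sub_zero, add_zero] at this
    exact (besselEntire_wronskian_pos hpos hν.2).ne this

/-! ### The positive zeros of `J_ν` -/

lemma besselJ_eq_zero_iff {ν y : ℝ} (hy : 0 < y) :
    besselJ ν y = 0 ↔ besselEntire ν ((y / 2) ^ 2) = 0 := by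
  have h : (y / 2) ^ ν ≠ 0 := (Real.rpow_pos_of_pos (by positivity) ν).ne'
  rw [besselJ_eq hy, mul_eq_zero, or_iff_right h]

lemma hasDerivAt_besselEntire_sq {ν : ℝ} (hν : -1 < ν) (y : ℝ) :
    HasDerivAt (fun y => besselEntire ν ((y / 2) ^ 2))
      (-besselEntire (ν + 1) ((y / 2) ^ 2) * (y / 2)) y := by
  have h1 : HasDerivAt (fun y : ℝ => (y / 2) ^ 2) (y / 2) y := by
    refine (((hasDerivAt_id y).div_const 2).pow 2).congr_deriv ?_
    simp only [id]
    ring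
  exact (hasDerivAt_besselEntire hν _).comp y h1

lemma eventually_besselEntire_sq_ne_zero {ν : ℝ} (hν : ν ∈ Ioo (-1 : ℝ) 1) (hν0 : ν ≠ 0) (b : ℝ) :
    ∀ᶠ y in 𝓝[≠] b, besselEntire ν ((y / 2) ^ 2) ≠ 0 := by
  have hd := hasDerivAt_besselEntire_sq hν.1 b
  by_cases hb : besselEntire ν ((b / 2) ^ 2) = 0
  · have hb0 : b ≠ 0 := by
      rintro rfl
      exact (besselEntire_pos_of_nonpos hν.1 (by norm_num : ((0 : ℝ) / 2) ^ 2 ≤ 0)).ne' hb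
    refine hd.eventually_ne ?_
    exact mul_ne_zero (neg_ne_zero.2 (besselEntire_add_one_ne_zero hν hν0 hb)) (by positivity)
  · exact (hd.continuousAt.eventually_ne hb).filter_mono nhdsWithin_le_nhds

/-- Sturm comparison with `sin (y - a)`: since `|ν| ≤ 1/2`, the function `√y J_ν(y)` solves
`g'' = -q g` with `q ≥ 1`, hence it cannot keep its sign on an interval of length `π`. -/
lemma not_forall_pos_besselEntire_sq {ν : ℝ} (hν : ν ∈ Icc (-1 / 2 : ℝ) (1 / 2)) {a : ℝ}
    (ha : 0 < a) (s : ℝ) :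
    ¬ ∀ y ∈ Icc a (a + Real.pi), 0 < s * besselEntire ν ((y / 2) ^ 2) := by
  intro hpos
  have hν1 : -1 < ν := by linarith [hν.1]
  set G : ℝ → ℝ := fun y => besselEntire ν ((y / 2) ^ 2)
  set H : ℝ → ℝ := fun y => besselEntire (ν + 1) ((y / 2) ^ 2)
  set q : ℝ → ℝ := fun y => y ^ (ν + 1 / 2) with hq
  -- up to the sign `s`, `W` is the Wronskian of `y ↦ y ^ (ν + 1/2) G y` and `sin (y - a)`
  set W : ℝ → ℝ := fun y => s * (q y * (((ν + 1 / 2) / y * G y - y / 2 * H y) *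
    Real.sin (y - a) - G y * Real.cos (y - a))) with hW
  have hW' : ∀ y, 0 < y → HasDerivAt W
      (-((1 / 4 - ν ^ 2) / y ^ 2 * q y * (s * G y) * Real.sin (y - a))) y := by
    intro y hy
    have dG : HasDerivAt G (-H y * (y / 2)) y := hasDerivAt_besselEntire_sq hν1 y
    have dH : HasDerivAt H (-besselEntire (ν + 1 + 1) ((y / 2) ^ 2) * (y / 2)) y :=
      hasDerivAt_besselEntire_sq (by linarith) y
    have hrec := besselEntire_recurrence (μ := ν + 1) (by linarith) ((y / 2) ^ 2)
    rw [add_sub_cancel_right] at hrec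
    change (ν + 1) * H y - _ = G y at hrec
    have dq : HasDerivAt q ((ν + 1 / 2) / y * q y) y := by
      refine (Real.hasDerivAt_rpow_const (Or.inl hy.ne')).congr_deriv ?_
      rw [Real.rpow_sub_one hy.ne']
      simp only [hq]
      ring
    have dinv : HasDerivAt (fun y : ℝ => (ν + 1 / 2) / y) (-(ν + 1 / 2) / y ^ 2) y := by
      refine ((hasDerivAt_inv hy.ne').const_mul (ν + 1 / 2)).congr_deriv ?_
      ring
    have dsin : HasDerivAt (fun y => Real.sin (y - a)) (Real.cos (y - a)) y := by
      simpa using ((hasDerivAt_id y).sub_const a).sin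
    have dcos : HasDerivAt (fun y => Real.cos (y - a)) (-Real.sin (y - a)) y := by
      simpa using ((hasDerivAt_id y).sub_const a).cos
    have dhalf : HasDerivAt (fun y : ℝ => y / 2) (1 / 2) y := (hasDerivAt_id y).div_const 2
    refine ((dq.mul ((((dinv.mul dG).sub (dhalf.mul dH)).mul dsin).sub
      (dG.mul dcos))).const_mul s).congr_deriv ?_
    simp only [Pi.mul_apply, Pi.sub_apply]
    have e : y / 2 * (-besselEntire (ν + 1 + 1) ((y / 2) ^ 2) * (y / 2)) =
        G y - (ν + 1) * H y := by rw [← hrec]; ring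
    rw [e]
    field_simp
    ring
  have hanti : AntitoneOn W (Icc a (a + Real.pi)) := by
    have hy0 : ∀ y ∈ Icc a (a + Real.pi), 0 < y := fun y hy => ha.trans_le hy.1
    refine antitoneOn_of_deriv_nonpos (convex_Icc _ _)
      (fun y hy => (hW' y (hy0 y hy)).continuousAt.continuousWithinAt)
      (fun y hy => (hW' y (hy0 y (interior_subset hy))).differentiableAt.differentiableWithinAt)
      fun y hy => ?_
    have hy1 := interior_subset hy
    rw [(hW' y (hy0 y hy1)).deriv]
    have h1 : 0 ≤ Real.sin (y - a) :=
      Real.sin_nonneg_of_nonneg_of_le_pi (by linarith [hy1.1]) (by linarith [hy1.2])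
    have h2 : 0 ≤ 1 / 4 - ν ^ 2 := by nlinarith [hν.1, hν.2]
    have h3 : 0 < q y := Real.rpow_pos_of_pos (hy0 y hy1) _
    have h4 : 0 < s * G y := hpos y hy1
    have := hy0 y hy1
    have : 0 ≤ (1 / 4 - ν ^ 2) / y ^ 2 * q y * (s * G y) * Real.sin (y - a) := by positivity
    linarith
  have hle : a ≤ a + Real.pi := by linarith [Real.pi_pos]
  have hcmp := hanti (left_mem_Icc.2 hle) (right_mem_Icc.2 hle) hle
  have e1 : W a = -(q a * (s * G a)) := by simp [hW]; ring
  have e2 : W (a + Real.pi) = q (a + Real.pi) * (s * G (a + Real.pi)) := by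
    simp [hW]; ring
  have p1 : 0 < q a * (s * G a) :=
    mul_pos (Real.rpow_pos_of_pos ha _) (hpos a (left_mem_Icc.2 hle))
  have p2 : 0 < q (a + Real.pi) * (s * G (a + Real.pi)) :=
    mul_pos (Real.rpow_pos_of_pos (by linarith) _) (hpos _ (right_mem_Icc.2 hle))
  linarith

lemma exists_gt_mem_besselZeroSet {ν : ℝ} (hν : ν ∈ Icc (-1 / 2 : ℝ) (1 / 2)) {b : ℝ}
    (hb : 0 ≤ b) : ∃ y, b < y ∧ y ∈ besselZeroSet ν := by
  have hν1 : -1 < ν := by linarith [hν.1]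
  by_contra! hno
  have ha : 0 < b + 1 := by linarith
  have hcont : ContinuousOn (fun y => besselEntire ν ((y / 2) ^ 2))
      (Icc (b + 1) (b + 1 + Real.pi)) := fun y _ =>
    (hasDerivAt_besselEntire_sq hν1 y).continuousAt.continuousWithinAt
  have hne : ∀ y ∈ Icc (b + 1) (b + 1 + Real.pi), besselEntire ν ((y / 2) ^ 2) ≠ 0 := by
    intro y hy h
    have hy0 : 0 < y := by linarith [hy.1]
    exact hno y (by linarith [hy.1]) ⟨hy0, (besselJ_eq_zero_iff hy0).2 h⟩
  have hpi := Real.pi_pos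
  have hle : b + 1 ≤ b + 1 + Real.pi := by linarith
  have hsign : ∀ y ∈ Icc (b + 1) (b + 1 + Real.pi),
      0 < besselEntire ν (((b + 1) / 2) ^ 2) * besselEntire ν ((y / 2) ^ 2) := by
    intro y hy
    by_contra! hneg
    have hsub : Icc (b + 1) y ⊆ Icc (b + 1) (b + 1 + Real.pi) := Icc_subset_Icc_right hy.2
    have h0 : (0 : ℝ) ∈ (fun y => besselEntire ν ((y / 2) ^ 2)) '' Icc (b + 1) y := by
      rcases mul_nonpos_iff.1 hneg with ⟨h1, h2⟩ | ⟨h1, h2⟩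
      · exact intermediate_value_Icc' hy.1 (hcont.mono hsub) ⟨h2, h1⟩
      · exact intermediate_value_Icc hy.1 (hcont.mono hsub) ⟨h1, h2⟩
    obtain ⟨z, hz, hz0⟩ := h0
    exact hne z (hsub hz) hz0
  exact not_forall_pos_besselEntire_sq hν ha _ hsign

/-- Each `besselZero ν (n + 1)` is a positive zero, namely the least one beyond
`besselZero ν n`. -/
lemma besselZero_succ_isLeast {ν : ℝ} (hν : ν ∈ Icc (-1 / 2 : ℝ) (1 / 2)) (hν0 : ν ≠ 0) (n : ℕ) :
    IsLeast {y | besselZero ν n < y ∧ y ∈ besselZeroSet ν} (besselZero ν (n + 1)) := by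
  have hν1 : ν ∈ Ioo (-1 : ℝ) 1 := ⟨by linarith [hν.1], by linarith [hν.2]⟩
  have key : ∀ b : ℝ, 0 ≤ b → IsLeast {y | b < y ∧ y ∈ besselZeroSet ν}
      (sInf {y | b < y ∧ y ∈ besselZeroSet ν}) := by
    intro b hb
    obtain ⟨c, hbc, hc⟩ := mem_nhdsGT_iff_exists_Ioo_subset.1
      ((eventually_besselEntire_sq_ne_zero hν1 hν0 b).filter_mono
        (nhdsWithin_mono b fun y (hy : b < y) => hy.ne'))
    have hbc' : b < c := hbc
    -- zeros do not accumulate at `b`, so the zeros beyond `b` form a closed set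
    have hset : {y | b < y ∧ y ∈ besselZeroSet ν} =
        Ici c ∩ (fun y => besselEntire ν ((y / 2) ^ 2)) ⁻¹' {0} := by
      ext y
      constructor
      · rintro ⟨h1, h2, h3⟩
        have h4 := (besselJ_eq_zero_iff h2).1 h3
        refine ⟨?_, h4⟩
        by_contra! hlt
        exact hc ⟨h1, not_le.1 hlt⟩ h4
      · rintro ⟨h1, h2⟩
        have h1' : c ≤ y := h1
        have hy : 0 < y := by linarith
        exact ⟨by linarith, hy, (besselJ_eq_zero_iff hy).2 h2⟩
    have hclosed : IsClosed {y | b < y ∧ y ∈ besselZeroSet ν} := by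
      rw [hset]
      refine isClosed_Ici.inter (isClosed_singleton.preimage ?_)
      exact continuous_iff_continuousAt.2 fun y =>
        (hasDerivAt_besselEntire_sq hν1.1 y).continuousAt
    have hbdd : BddBelow {y | b < y ∧ y ∈ besselZeroSet ν} := ⟨b, fun y hy => hy.1.le⟩
    exact ⟨hclosed.csInf_mem (exists_gt_mem_besselZeroSet hν hb) hbdd, fun y hy =>
      csInf_le hbdd hy⟩
  have hnonneg : 0 ≤ besselZero ν n := by
    induction n with
    | zero => exact le_rfl
    | succ k ih => exact (key _ ih).1.2.1.le
  exact key _ hnonneg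

lemma besselZero_succ_pos {ν : ℝ} (hν : ν ∈ Icc (-1 / 2 : ℝ) (1 / 2)) (hν0 : ν ≠ 0) (n : ℕ) :
    0 < besselZero ν (n + 1) := (besselZero_succ_isLeast hν hν0 n).1.2.1

lemma besselEntire_besselZero_succ {ν : ℝ} (hν : ν ∈ Icc (-1 / 2 : ℝ) (1 / 2)) (hν0 : ν ≠ 0)
    (n : ℕ) : besselEntire ν ((besselZero ν (n + 1) / 2) ^ 2) = 0 :=
  (besselJ_eq_zero_iff (besselZero_succ_pos hν hν0 n)).1 (besselZero_succ_isLeast hν hν0 n).1.2.2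

lemma strictMono_besselZero {ν : ℝ} (hν : ν ∈ Icc (-1 / 2 : ℝ) (1 / 2)) (hν0 : ν ≠ 0) :
    StrictMono (besselZero ν) :=
  strictMono_nat_of_lt_succ fun n => (besselZero_succ_isLeast hν hν0 n).1.1

lemma range_besselZero_succ {ν : ℝ} (hν : ν ∈ Icc (-1 / 2 : ℝ) (1 / 2)) (hν0 : ν ≠ 0) :
    range (fun n : ℕ => besselZero ν (n + 1)) = besselZeroSet ν := by
  have hν1 : ν ∈ Ioo (-1 : ℝ) 1 := ⟨by linarith [hν.1], by linarith [hν.2]⟩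
  have hmono := strictMono_besselZero hν hν0
  refine Subset.antisymm ?_ fun y hy => ?_
  · rintro _ ⟨n, rfl⟩
    exact (besselZero_succ_isLeast hν hν0 n).1.2
  by_contra hno
  have hlt : ∀ n, besselZero ν n < y := by
    intro n
    induction n with
    | zero => exact hy.1
    | succ k ih =>
      exact lt_of_le_of_ne ((besselZero_succ_isLeast hν hν0 k).2 ⟨ih, hy⟩) fun h => hno ⟨k, h⟩
  -- a missed zero would bound the sequence, whose limit would be a point of accumulation of zeros
  have htend := tendsto_atTop_ciSup hmono.monotone ⟨y, by rintro _ ⟨n, rfl⟩; exact (hlt n).le⟩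
  set l := ⨆ n, besselZero ν n
  have hne : ∀ n, besselZero ν n ≠ l := fun n h => by
    have := hmono.monotone.ge_of_tendsto htend (n + 1)
    have := hmono (Nat.lt_succ_self n)
    simp only [Nat.succ_eq_add_one] at this
    linarith
  have htend' : Tendsto (besselZero ν) atTop (𝓝[≠] l) :=
    tendsto_nhdsWithin_iff.2 ⟨htend, Eventually.of_forall hne⟩
  obtain ⟨N, hN⟩ := (htend'.eventually
    (eventually_besselEntire_sq_ne_zero hν1 hν0 l)).exists_forall_of_atTop
  exact hN (N + 1) (Nat.le_succ N) (besselEntire_besselZero_succ hν hν0 N)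

/-- The positive zeros of `J_ν`, in the variable `z = (y/2)²` of the entire function `F_ν`. -/
lemma besselEntire_eq_zero_iff {ν z : ℝ} (hν : ν ∈ Icc (-1 / 2 : ℝ) (1 / 2)) (hν0 : ν ≠ 0) :
    besselEntire ν z = 0 ↔ ∃ n : ℕ, z = (besselZero ν (n + 1) / 2) ^ 2 := by
  constructor
  · intro h
    have hz : 0 < z := by
      by_contra! hz
      exact (besselEntire_pos_of_nonpos (by linarith [hν.1]) hz).ne' h
    have hs : 0 < 2 * Real.sqrt z := by positivity
    have e : (2 * Real.sqrt z / 2) ^ 2 = z := by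
      rw [mul_div_cancel_left₀ _ two_ne_zero, Real.sq_sqrt hz.le]
    have hmem : 2 * Real.sqrt z ∈ besselZeroSet ν :=
      ⟨hs, (besselJ_eq_zero_iff hs).2 (by rw [e]; exact h)⟩
    rw [← range_besselZero_succ hν hν0] at hmem
    obtain ⟨n, hn⟩ := hmem
    exact ⟨n, by simp only at hn; rw [hn, e]⟩
  · rintro ⟨n, rfl⟩
    exact besselEntire_besselZero_succ hν hν0 n

/-! ### Weak solutions as pairs of absolutely continuous functions -/

lemma intervalIntegrable_abs_rpow_neg {α : ℝ} (hα : α < 1) (a b : ℝ) :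
    IntervalIntegrable (fun x : ℝ => |x| ^ (-α)) volume a b := by
  have hpos : ∀ b : ℝ, 0 ≤ b → IntervalIntegrable (fun x : ℝ => |x| ^ (-α)) volume 0 b := by
    intro b hb
    refine (intervalIntegral.intervalIntegrable_rpow' (by linarith : -1 < -α)).congr ?_
    intro x hx
    rw [uIoc_of_le hb] at hx
    simp only [abs_of_pos hx.1]
  have h0 : ∀ b : ℝ, IntervalIntegrable (fun x : ℝ => |x| ^ (-α)) volume 0 b := by
    intro b
    rcases le_total 0 b with hb | hb
    · exact hpos b hb
    · rw [IntervalIntegrable.iff_comp_neg]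
      simpa using hpos (-b) (by linarith)
  exact (h0 a).symm.trans (h0 b)

lemma muI_eq_restrict_Icc : muI = volume.restrict (Icc (-1 : ℝ) 1) :=
  Measure.restrict_congr_set Ioo_ae_eq_Icc

lemma muI_eq_restrict_uIoc : muI = volume.restrict (uIoc (-1 : ℝ) 1) := by
  rw [uIoc_of_le (by norm_num)]
  exact Measure.restrict_congr_set Ioo_ae_eq_Ioc

lemma intervalIntegral_eq_integral_muI (f : ℝ → ℝ) : ∫ x in (-1 : ℝ)..1, f x = ∫ x, f x ∂muI := by
  rw [intervalIntegral.integral_of_le (by norm_num), ← uIoc_of_le (by norm_num),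
    muI_eq_restrict_uIoc]

lemma ae_muI_iff {p : ℝ → Prop} :
    (∀ᵐ x ∂muI, p x) ↔ ∀ᵐ x, x ∈ uIcc (-1 : ℝ) 1 → p x := by
  rw [muI_eq_restrict_Icc, ae_restrict_iff' measurableSet_Icc, uIcc_of_le (by norm_num)]

lemma ae_muI_mem_Ioo_ne_zero : ∀ᵐ x ∂muI, x ∈ Ioo (-1 : ℝ) 1 ∧ x ≠ 0 := by
  refine (ae_restrict_mem measurableSet_Ioo).and (ae_restrict_of_ae ?_)
  exact Measure.ae_ne volume 0

/-- A continuous function with an integrable derivative off the origin is absolutely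
continuous. -/
lemma absolutelyContinuousOnInterval_of_hasDerivAt_off_zero {u g : ℝ → ℝ} (hu : Continuous u)
    (hd : ∀ x, x ≠ 0 → HasDerivAt u (g x) x) (hg : ∀ a b, IntervalIntegrable g volume a b) :
    AbsolutelyContinuousOnInterval u (-1) 1 := by
  have h : u = fun x => u 0 + ∫ s in (0 : ℝ)..x, g s := by
    funext x
    rw [integral_eq_of_hasDerivAt_off_countable u g (countable_singleton 0) hu.continuousOn
      (fun y hy => hd y hy.2) (hg 0 x)]
    ring
  rw [h]
  have hc : AbsolutelyContinuousOnInterval (fun _ : ℝ => u 0) (-1) 1 :=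
    contDiffOn_const.absolutelyContinuousOnInterval
  exact hc.add ((hg (-1) 1).absolutelyContinuousOnInterval_intervalIntegral
    (by rw [uIcc_of_le (by norm_num)]; constructor <;> norm_num))

/-- The pair `(u, w)` consists of absolutely continuous functions on `[-1, 1]` with
`u' = |x|^(-α) w` and `w' = -f` almost everywhere, so that `w` is the flux of `u` and
`-(|x|^α u')' = f`. -/
structure IsFluxPair (α : ℝ) (f u w : ℝ → ℝ) : Prop where
  absCont : AbsolutelyContinuousOnInterval u (-1) 1
  absCont_flux : AbsolutelyContinuousOnInterval w (-1) 1
  deriv_eq : ∀ᵐ x ∂muI, deriv u x = |x| ^ (-α) * w x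
  deriv_flux_eq : ∀ᵐ x ∂muI, deriv w x = -f x

namespace IsFluxPair

variable {α : ℝ} {f g u v w z : ℝ → ℝ}

lemma continuousOn (h : IsFluxPair α f u w) : ContinuousOn u (Icc (-1) 1) := by
  simpa [uIcc_of_le] using h.absCont.continuousOn

lemma continuousOn_flux (h : IsFluxPair α f u w) : ContinuousOn w (Icc (-1) 1) := by
  simpa [uIcc_of_le] using h.absCont_flux.continuousOn

lemma const_mul (h : IsFluxPair α f u w) (c : ℝ) :
    IsFluxPair α (fun x => c * f x) (fun x => c * u x) (fun x => c * w x) where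
  absCont := h.absCont.const_mul c
  absCont_flux := h.absCont_flux.const_mul c
  deriv_eq := by
    filter_upwards [h.deriv_eq] with x hx
    rw [deriv_const_mul_field, hx]
    ring
  deriv_flux_eq := by
    filter_upwards [h.deriv_flux_eq] with x hx
    rw [deriv_const_mul_field, hx]
    ring

lemma congr_right (h : IsFluxPair α f u w) (hfg : f =ᵐ[muI] g) : IsFluxPair α g u w where
  absCont := h.absCont
  absCont_flux := h.absCont_flux
  deriv_eq := h.deriv_eq
  deriv_flux_eq := by
    filter_upwards [h.deriv_flux_eq, hfg] with x hx hx'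
    rw [hx, hx']

lemma intervalIntegrable (h : IsFluxPair α f u w) (hα : α < 1) {a b : ℝ}
    (ha : a ∈ Icc (-1 : ℝ) 1) (hb : b ∈ Icc (-1 : ℝ) 1) :
    IntervalIntegrable (fun x => |x| ^ (-α) * w x) volume a b :=
  (intervalIntegrable_abs_rpow_neg hα a b).mul_continuousOn
    (h.continuousOn_flux.mono (uIcc_subset_Icc ha hb))

lemma integral_eq (h : IsFluxPair α f u w) {x : ℝ} (hx : x ∈ Icc (-1 : ℝ) 1) :
    u x = u (-1) + ∫ s in (-1 : ℝ)..x, |s| ^ (-α) * w s := by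
  have hsub : uIcc (-1) x ⊆ uIcc (-1 : ℝ) 1 := by
    rw [uIcc_of_le hx.1, uIcc_of_le (by norm_num)]
    exact Icc_subset_Icc_right hx.2
  have h1 := (h.absCont.mono hsub).integral_deriv_eq_sub
  have h2 : ∫ s in (-1 : ℝ)..x, deriv u s = ∫ s in (-1 : ℝ)..x, |s| ^ (-α) * w s := by
    refine intervalIntegral.integral_congr_ae ?_
    filter_upwards [ae_muI_iff.1 h.deriv_eq] with s hs hs'
    exact hs (hsub (uIoc_subset_uIcc hs'))
  rw [← h2, h1]
  ring

/-- Away from the origin the equation `u' = |x|^(-α) w` holds everywhere, since its right hand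
side is continuous there. -/
lemma hasDerivAt (h : IsFluxPair α f u w) (hα : α < 1) {x : ℝ} (hx : x ∈ Ioo (-1 : ℝ) 1)
    (hx0 : x ≠ 0) : HasDerivAt u (|x| ^ (-α) * w x) x := by
  have hc : ∀ y ∈ Ioo (-1 : ℝ) 1 ∩ {0}ᶜ, ContinuousAt (fun s => |s| ^ (-α) * w s) y := by
    intro y hy
    refine ContinuousAt.mul ?_ (h.continuousOn_flux.continuousAt (Icc_mem_nhds hy.1.1 hy.1.2))
    exact continuous_abs.continuousAt.rpow_const (Or.inl (abs_ne_zero.2 hy.2))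
  have hopen : IsOpen (Ioo (-1 : ℝ) 1 ∩ {0}ᶜ) := isOpen_Ioo.inter isOpen_compl_singleton
  have h1 := intervalIntegral.integral_hasDerivAt_right
    (h.intervalIntegrable hα (a := -1) (by norm_num) (Ioo_subset_Icc_self hx))
    (ContinuousOn.stronglyMeasurableAtFilter hopen
      (fun y hy => (hc y hy).continuousWithinAt) x ⟨hx, hx0⟩) (hc x ⟨hx, hx0⟩)
  refine (h1.const_add (u (-1))).congr_of_eventuallyEq ?_
  filter_upwards [Ioo_mem_nhds hx.1 hx.2] with y hy
  exact h.integral_eq (Ioo_subset_Icc_self hy)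

lemma flux_eq (h : IsFluxPair α f u w) (hα : α < 1) {x : ℝ} (hx : x ∈ Ioo (-1 : ℝ) 1)
    (hx0 : x ≠ 0) : flux α u x = w x := by
  rw [flux, (h.hasDerivAt hα hx hx0).deriv, ← mul_assoc,
    ← Real.rpow_add (abs_pos.2 hx0), add_neg_cancel, Real.rpow_zero, one_mul]

lemma degOp_eq (h : IsFluxPair α f u w) (hα : α < 1) : ∀ᵐ x ∂muI, -degOp α u x = f x := by
  filter_upwards [ae_muI_mem_Ioo_ne_zero, h.deriv_flux_eq] with x hx hx'
  have hev : flux α u =ᶠ[𝓝 x] w := by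
    filter_upwards [Ioo_mem_nhds hx.1.1 hx.1.2, isOpen_ne.mem_nhds hx.2] with y hy hy0
    exact h.flux_eq hα hy hy0
  rw [degOp, hev.deriv_eq, hx', neg_neg]

lemma memLp (h : IsFluxPair α f u w) : MemLp u 2 muI := by
  obtain ⟨C, hC⟩ := h.absCont.exists_bound
  refine MemLp.of_bound ((h.continuousOn.mono Ioo_subset_Icc_self).aestronglyMeasurable
    measurableSet_Ioo) C ?_
  exact ae_muI_iff.2 (Eventually.of_forall hC)

lemma memH2 (h : IsFluxPair α f u w) (hα : α < 1) (hf : MemLp f 2 muI) (hl : u (-1) = 0)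
    (hr : u 1 = 0) : MemH2 α u where
  memLp := h.memLp
  absCont := h.absCont
  energy := by
    have h1 : IntervalIntegrable (fun x => |x| ^ (-α) * (w x * w x)) volume (-1) 1 := by
      simpa only [mul_assoc] using (h.intervalIntegrable hα (a := -1) (b := 1)
        (by norm_num) (by norm_num)).mul_continuousOn h.absCont_flux.continuousOn
    rw [intervalIntegrable_iff, IntegrableOn, ← muI_eq_restrict_uIoc] at h1
    refine h1.congr ?_
    filter_upwards [ae_muI_mem_Ioo_ne_zero] with x hx
    have e : |x| ^ α * |x| ^ (-α) = 1 := by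
      rw [← Real.rpow_add (abs_pos.2 hx.2), add_neg_cancel, Real.rpow_zero]
    rw [(h.hasDerivAt hα hx.1 hx.2).deriv]
    linear_combination (-(|x| ^ (-α) * w x ^ 2)) * e
  left := hl
  right := hr
  flux_absCont := by
    refine ⟨w, h.absCont_flux, ?_, ?_⟩
    · filter_upwards [ae_muI_mem_Ioo_ne_zero] with x hx
      exact (h.flux_eq hα hx.1 hx.2).symm
    · exact hf.neg.ae_eq (h.deriv_flux_eq.mono fun x hx => hx.symm)

/-- If `u` vanishes on `(-1, 1)`, then so does its flux. -/
lemma flux_eq_zero (h : IsFluxPair α f u w) (hα : α < 1) (hu : u =ᵐ[muI] 0) :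
    ∀ x ∈ Ioo (-1 : ℝ) 1, w x = 0 := by
  have h0 : EqOn u 0 (Ioo (-1) 1) := Measure.eqOn_open_of_ae_eq hu isOpen_Ioo
    (h.continuousOn.mono Ioo_subset_Icc_self) continuousOn_const
  refine Measure.eqOn_open_of_ae_eq (g := 0) (μ := volume) ?_ isOpen_Ioo
    (h.continuousOn_flux.mono Ioo_subset_Icc_self) continuousOn_const
  filter_upwards [ae_muI_mem_Ioo_ne_zero] with x hx
  have hev : u =ᶠ[𝓝 x] fun _ => 0 := by
    filter_upwards [Ioo_mem_nhds hx.1.1 hx.1.2] with y hy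
    exact h0 hy
  rw [← h.flux_eq hα hx.1 hx.2, flux, hev.deriv_eq]
  simp

/-- Green's identity: `∫ f v = ∫ |x|^(-α) w z` if `(u, w)` solves the problem with right hand
side `f`, `z` is the flux of `v`, and `v` vanishes at the end points. -/
lemma integral_mul_eq (h : IsFluxPair α f u w) (k : IsFluxPair α g v z) (hl : v (-1) = 0)
    (hr : v 1 = 0) : ∫ x, f x * v x ∂muI = ∫ x, |x| ^ (-α) * (w x * z x) ∂muI := by
  have h1 := k.absCont.integral_mul_deriv_eq_deriv_mul h.absCont_flux
  rw [hl, hr, zero_mul, zero_mul, sub_zero, zero_sub, intervalIntegral_eq_integral_muI,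
    intervalIntegral_eq_integral_muI] at h1
  have h2 : ∫ x, v x * deriv w x ∂muI = -∫ x, f x * v x ∂muI := by
    rw [← integral_neg]
    refine integral_congr_ae ?_
    filter_upwards [h.deriv_flux_eq] with x hx
    rw [hx]
    ring
  have h3 : ∫ x, deriv v x * w x ∂muI = ∫ x, |x| ^ (-α) * (w x * z x) ∂muI := by
    refine integral_congr_ae ?_
    filter_upwards [k.deriv_eq] with x hx
    rw [hx]
    ring
  rw [h2, h3, neg_inj] at h1
  exact h1

/-- The Wronskian of two solutions of the homogeneous equation is constant. -/
lemma exists_wronskian_eq {lam : ℝ} (h : IsFluxPair α (fun x => lam * u x) u w)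
    (k : IsFluxPair α (fun x => lam * v x) v z) :
    ∃ C, ∀ x ∈ Icc (-1 : ℝ) 1, u x * z x - w x * v x = C := by
  have h1 : AbsolutelyContinuousOnInterval (u * z - w * v) (-1) 1 :=
    (h.absCont.mul k.absCont_flux).sub (h.absCont_flux.mul k.absCont)
  obtain ⟨C, hC⟩ := h1.const_of_ae_hasDerivAt_zero (by
    filter_upwards [ae_muI_iff.1 h.deriv_eq, ae_muI_iff.1 h.deriv_flux_eq,
      ae_muI_iff.1 k.deriv_eq, ae_muI_iff.1 k.deriv_flux_eq, h.absCont.ae_differentiableAt,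
      h.absCont_flux.ae_differentiableAt, k.absCont.ae_differentiableAt,
      k.absCont_flux.ae_differentiableAt] with x a1 a2 a3 a4 d1 d2 d3 d4 hx
    have e1 := (d1 hx).hasDerivAt
    have e2 := (d2 hx).hasDerivAt
    have e3 := (d3 hx).hasDerivAt
    have e4 := (d4 hx).hasDerivAt
    rw [a1 hx] at e1
    rw [a2 hx] at e2
    rw [a3 hx] at e3
    rw [a4 hx] at e4
    refine ((e1.mul e4).sub (e2.mul e3)).congr_deriv ?_
    ring)
  exact ⟨C, fun x hx => hC x (by rwa [uIcc_of_le (by norm_num)])⟩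

end IsFluxPair

/-- Here `degOp α u` is first identified with `w'`, where `w` is the absolutely continuous
representative of the flux: the two agree off the origin, hence so do their derivatives. -/
lemma MemH2.exists_isFluxPair {α : ℝ} (hα : α < 1) {f u : ℝ → ℝ} (hu : MemH2 α u)
    (hf : ∀ᵐ x ∂muI, -degOp α u x = f x) : ∃ w, IsFluxPair α f u w := by
  obtain ⟨w, hw, hwu, -⟩ := hu.flux_absCont
  have h : IsFluxPair α (fun x => -deriv w x) u w :=
    { absCont := hu.absCont
      absCont_flux := hw
      deriv_eq := by
        filter_upwards [ae_muI_mem_Ioo_ne_zero, hwu] with x hx hx'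
        rw [hx', flux, ← mul_assoc, ← Real.rpow_add (abs_pos.2 hx.2), neg_add_cancel,
          Real.rpow_zero, one_mul]
      deriv_flux_eq := Eventually.of_forall fun x => (neg_neg _).symm }
  refine ⟨w, h.congr_right ?_⟩
  filter_upwards [h.degOp_eq hα, hf] with x h1 h2
  rw [← h1, h2]

/-- The eigenvalue problem as a first order system for `u` and its flux. -/
lemma mem_eigenSet_iff {α lam : ℝ} (hα : α < 1) {g : L2I} :
    g ∈ eigenSet α lam ↔ ∃ u w, IsFluxPair α (fun x => lam * u x) u w ∧ u (-1) = 0 ∧ u 1 = 0 ∧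
      g =ᵐ[muI] u := by
  constructor
  · rintro ⟨u, hu, hg, hd⟩
    obtain ⟨w, hw⟩ := hu.exists_isFluxPair hα hd
    exact ⟨u, w, hw, hu.left, hu.right, hg⟩
  · rintro ⟨u, w, h, hl, hr, hg⟩
    exact ⟨u, h.memH2 hα (h.memLp.const_mul lam) hl hr, hg, h.degOp_eq hα⟩

/-! ### The explicit even and odd solutions -/

lemma nuAlpha_eq {α : ℝ} (hα : α < 1) : nuAlpha α = (1 - α) / (2 - α) := by
  rw [nuAlpha, abs_of_neg (by linarith), neg_sub]

lemma nuAlpha_pos {α : ℝ} (hα : α < 1) : 0 < nuAlpha α := by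
  rw [nuAlpha_eq hα]
  exact div_pos (by linarith) (by linarith)

lemma nuAlpha_le {α : ℝ} (hα0 : 0 ≤ α) (hα : α < 1) : nuAlpha α ≤ 1 / 2 := by
  rw [nuAlpha_eq hα, div_le_div_iff₀ (by linarith) (by norm_num)]
  linarith

lemma nuAlpha_lt_one {α : ℝ} (hα : α < 1) : nuAlpha α < 1 := by
  rw [nuAlpha_eq hα, div_lt_one (by linarith)]
  linarith

lemma two_sub_mul_nuAlpha {α : ℝ} (hα : α < 1) : (2 - α) * nuAlpha α = 1 - α := by
  rw [nuAlpha_eq hα, mul_div_cancel₀]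
  linarith

/-- The argument `λ |x|^(2-α) / (2-α)²` of the entire functions in the explicit solutions. -/
noncomputable def besselArg (α lam x : ℝ) : ℝ := lam / (2 - α) ^ 2 * |x| ^ (2 - α)

/-- The even solution of `-(|x|^α u')' = λ u`, equal to `1 / Γ(1 - ν_α)` at the origin. -/
noncomputable def evenSol (α lam x : ℝ) : ℝ := besselEntire (-nuAlpha α) (besselArg α lam x)

/-- The flux `|x|^α u'` of `evenSol`. -/
noncomputable def evenFlux (α lam x : ℝ) : ℝ :=
  -(lam / (2 - α)) * (x * besselEntire (1 - nuAlpha α) (besselArg α lam x))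

/-- The odd solution of `-(|x|^α u')' = λ u`; the factor `x |x|^(-α)` is `|x|^(1-α)` times the
sign of `x`. -/
noncomputable def oddSol (α lam x : ℝ) : ℝ :=
  x * |x| ^ (-α) * besselEntire (nuAlpha α) (besselArg α lam x)

/-- The flux `|x|^α u'` of `oddSol`. -/
noncomputable def oddFlux (α lam x : ℝ) : ℝ :=
  (2 - α) * besselEntire (nuAlpha α - 1) (besselArg α lam x)

lemma hasDerivAt_abs_rpow_off_zero (p : ℝ) {x : ℝ} (hx : x ≠ 0) :
    HasDerivAt (fun x : ℝ => |x| ^ p) (p * |x| ^ p / x) x := by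
  refine ((hasDerivAt_abs hx).rpow_const (p := p) (Or.inl (abs_ne_zero.2 hx))).congr_deriv ?_
  rw [Real.rpow_sub_one (abs_ne_zero.2 hx)]
  rcases lt_or_gt_of_ne hx with h | h
  · simp [h, abs_of_neg h]
    field_simp
  · simp [h, abs_of_pos h]
    field_simp

section

variable {α : ℝ} (lam : ℝ)

lemma besselArg_zero (hα : α < 1) : besselArg α lam 0 = 0 := by
  rw [besselArg, abs_zero, Real.zero_rpow (by linarith), mul_zero]

lemma continuous_besselArg (hα : α < 1) : Continuous (besselArg α lam) :=
  (continuous_abs.rpow_const fun _ => Or.inr (by linarith)).const_mul _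

lemma abs_rpow_two_sub (α : ℝ) {x : ℝ} (hx : x ≠ 0) : |x| ^ (2 - α) = |x| ^ (-α) * x ^ 2 := by
  rw [sub_eq_neg_add, Real.rpow_add (abs_pos.2 hx), Real.rpow_two, sq_abs]

lemma hasDerivAt_besselArg (hα : α < 1) {x : ℝ} (hx : x ≠ 0) :
    HasDerivAt (besselArg α lam) (lam / (2 - α) * (x * |x| ^ (-α))) x := by
  have h2 : 2 - α ≠ 0 := by linarith
  refine ((hasDerivAt_abs_rpow_off_zero (2 - α) hx).const_mul (lam / (2 - α) ^ 2)).congr_deriv ?_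
  rw [abs_rpow_two_sub α hx]
  field_simp

lemma hasDerivAt_besselEntire_besselArg (hα : α < 1) {ν : ℝ} (hν : -1 < ν) {x : ℝ} (hx : x ≠ 0) :
    HasDerivAt (fun x => besselEntire ν (besselArg α lam x))
      (-besselEntire (ν + 1) (besselArg α lam x) * (lam / (2 - α) * (x * |x| ^ (-α)))) x :=
  (hasDerivAt_besselEntire hν _).comp x (hasDerivAt_besselArg lam hα hx)

lemma continuous_mul_abs_rpow_neg (hα : α < 1) : Continuous fun x : ℝ => x * |x| ^ (-α) := by
  refine continuous_iff_continuousAt.2 fun x => ?_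
  by_cases hx : x = 0
  · subst hx
    rw [ContinuousAt, zero_mul]
    have h : Tendsto (fun x : ℝ => |x| ^ (1 - α)) (𝓝 0) (𝓝 0) := by
      have : ContinuousAt (fun x : ℝ => |x| ^ (1 - α)) 0 :=
        continuous_abs.continuousAt.rpow_const (Or.inr (by linarith))
      rw [ContinuousAt, abs_zero, Real.zero_rpow (by linarith)] at this
      exact this
    refine squeeze_zero_norm (fun x => ?_) h
    by_cases hx : x = 0
    · subst hx
      simp [Real.rpow_nonneg]
    · rw [Real.norm_eq_abs, abs_mul, abs_of_nonneg (Real.rpow_nonneg (abs_nonneg x) (-α)),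
        sub_eq_add_neg, Real.rpow_add (abs_pos.2 hx), Real.rpow_one]
  · exact continuousAt_id.mul
      (continuous_abs.continuousAt.rpow_const (Or.inl (abs_ne_zero.2 hx)))

lemma isFluxPair_of_hasDerivAt {u w : ℝ → ℝ} (hα : α < 1) (hu : Continuous u) (hw : Continuous w)
    (du : ∀ x, x ≠ 0 → HasDerivAt u (|x| ^ (-α) * w x) x)
    (dw : ∀ x, x ≠ 0 → HasDerivAt w (-(lam * u x)) x) :
    IsFluxPair α (fun x => lam * u x) u w where
  absCont := absolutelyContinuousOnInterval_of_hasDerivAt_off_zero hu du fun a b =>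
    (intervalIntegrable_abs_rpow_neg hα a b).mul_continuousOn hw.continuousOn
  absCont_flux := absolutelyContinuousOnInterval_of_hasDerivAt_off_zero hw dw fun a b =>
    (hu.const_mul lam).neg.intervalIntegrable a b
  deriv_eq := by
    filter_upwards [ae_muI_mem_Ioo_ne_zero] with x hx
    exact (du x hx.2).deriv
  deriv_flux_eq := by
    filter_upwards [ae_muI_mem_Ioo_ne_zero] with x hx
    exact (dw x hx.2).deriv

lemma isFluxPair_evenSol (hα : α < 1) :
    IsFluxPair α (fun x => lam * evenSol α lam x) (evenSol α lam) (evenFlux α lam) := by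
  have h2 : 2 - α ≠ 0 := by linarith
  have hν0 := nuAlpha_pos hα
  have hν1 := nuAlpha_lt_one hα
  have hν := two_sub_mul_nuAlpha hα
  have hc := continuous_besselArg (α := α) lam hα
  refine isFluxPair_of_hasDerivAt lam hα ((continuous_besselEntire (by linarith)).comp hc)
    ((continuous_id.mul ((continuous_besselEntire (by linarith)).comp hc)).const_mul _)
    (fun x hx => ?_) fun x hx => ?_
  · refine (hasDerivAt_besselEntire_besselArg lam hα (by linarith) hx).congr_deriv ?_
    rw [evenFlux, neg_add_eq_sub]
    ring
  · refine (((hasDerivAt_id x).mul (hasDerivAt_besselEntire_besselArg lam hα (ν := 1 - nuAlpha α)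
      (by linarith) hx)).const_mul (-(lam / (2 - α)))).congr_deriv ?_
    have r := besselEntire_recurrence (μ := 1 - nuAlpha α) (by linarith) (besselArg α lam x)
    rw [sub_sub_cancel_left] at r
    rw [evenSol, ← r, id]
    have e : besselArg α lam x = lam / (2 - α) ^ 2 * (|x| ^ (-α) * x ^ 2) := by
      rw [besselArg, abs_rpow_two_sub α hx]
    generalize besselEntire (1 - nuAlpha α) (besselArg α lam x) = A
    generalize besselEntire (1 - nuAlpha α + 1) (besselArg α lam x) = B
    rw [e]
    field_simp
    linear_combination (-(2 - α) * lam * A) * hν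

lemma isFluxPair_oddSol (hα : α < 1) :
    IsFluxPair α (fun x => lam * oddSol α lam x) (oddSol α lam) (oddFlux α lam) := by
  have h2 : 2 - α ≠ 0 := by linarith
  have hν0 := nuAlpha_pos hα
  have hν1 := nuAlpha_lt_one hα
  have hν := two_sub_mul_nuAlpha hα
  have hc := continuous_besselArg (α := α) lam hα
  refine isFluxPair_of_hasDerivAt lam hα
    ((continuous_mul_abs_rpow_neg hα).mul ((continuous_besselEntire (by linarith)).comp hc))
    (((continuous_besselEntire (by linarith)).comp hc).const_mul _)
    (fun x hx => ?_) fun x hx => ?_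
  · refine (((hasDerivAt_id x).mul (hasDerivAt_abs_rpow_off_zero (-α) hx)).mul
      (hasDerivAt_besselEntire_besselArg lam hα (ν := nuAlpha α)
      (by linarith) hx)).congr_deriv ?_
    have r := besselEntire_recurrence hν0 (besselArg α lam x)
    rw [oddFlux, ← r]
    have e : besselArg α lam x = lam / (2 - α) ^ 2 * (|x| ^ (-α) * x ^ 2) := by
      rw [besselArg, abs_rpow_two_sub α hx]
    simp only [Pi.mul_apply, id]
    generalize besselEntire (nuAlpha α) (besselArg α lam x) = A
    generalize besselEntire (nuAlpha α + 1) (besselArg α lam x) = B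
    rw [e]
    field_simp
    linear_combination (-(2 - α) * A) * hν
  · refine ((hasDerivAt_besselEntire_besselArg lam hα (ν := nuAlpha α - 1)
      (by linarith) hx).const_mul (2 - α)).congr_deriv ?_
    rw [oddSol, sub_add_cancel]
    field_simp

lemma evenSol_neg (x : ℝ) : evenSol α lam (-x) = evenSol α lam x := by
  rw [evenSol, evenSol, besselArg, besselArg, abs_neg]

lemma oddSol_neg (x : ℝ) : oddSol α lam (-x) = -oddSol α lam x := by
  rw [oddSol, oddSol, besselArg, besselArg, abs_neg]
  ring

lemma evenSol_one : evenSol α lam 1 = besselEntire (-nuAlpha α) (lam / (2 - α) ^ 2) := by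
  simp [evenSol, besselArg]

lemma oddSol_one : oddSol α lam 1 = besselEntire (nuAlpha α) (lam / (2 - α) ^ 2) := by
  simp [oddSol, besselArg]

/-- Every solution of the homogeneous equation is a combination of the even and the odd one:
its Wronskians with these two are constant, and Cramer's rule recovers it from them. -/
lemma IsFluxPair.exists_eq_evenSol_add_oddSol {lam : ℝ} (hα : α < 1) {u w : ℝ → ℝ}
    (h : IsFluxPair α (fun x => lam * u x) u w) :
    ∃ a b, ∀ x ∈ Icc (-1 : ℝ) 1, u x = a * evenSol α lam x + b * oddSol α lam x := by
  have hE := isFluxPair_evenSol lam hα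
  have hO := isFluxPair_oddSol lam hα
  obtain ⟨c, hc⟩ := hE.exists_wronskian_eq hO
  obtain ⟨a, ha⟩ := h.exists_wronskian_eq hO
  obtain ⟨b, hb⟩ := h.exists_wronskian_eq hE
  have hν0 := nuAlpha_pos hα
  have hν1 := nuAlpha_lt_one hα
  have hc0 : c ≠ 0 := by
    have h0 := hc 0 (by norm_num)
    simp only [evenSol, oddFlux, evenFlux, oddSol, besselArg_zero lam hα, zero_mul, mul_zero,
      sub_zero] at h0
    rw [← h0]
    exact (mul_pos (besselEntire_pos_of_nonpos (by linarith) le_rfl) (mul_pos (by linarith)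
      (besselEntire_pos_of_nonpos (by linarith) le_rfl))).ne'
  refine ⟨a / c, -b / c, fun x hx => ?_⟩
  have e1 := hc x hx
  have e2 := ha x hx
  have e3 := hb x hx
  field_simp
  rw [← e1, ← e2, ← e3]
  ring

end

/-! ### The eigenspaces -/

lemma eigenSet_eq_span {α lam c : ℝ} (hα : α < 1) {v z : ℝ → ℝ} {f : L2I}
    (h : IsFluxPair α (fun x => lam * v x) v z) (hl : v (-1) = 0) (hr : v 1 = 0) (hc : c ≠ 0)
    (hf : f =ᵐ[muI] fun x => c * v x)
    (hsol : ∀ g ∈ eigenSet α lam, ∃ b : ℝ, g =ᵐ[muI] fun x => b * v x) :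
    eigenSet α lam = (Submodule.span ℝ {f} : Submodule ℝ L2I) := by
  ext g
  rw [SetLike.mem_coe, Submodule.mem_span_singleton]
  constructor
  · intro hg
    obtain ⟨b, hb⟩ := hsol g hg
    refine ⟨b / c, Lp.ext ?_⟩
    filter_upwards [Lp.coeFn_smul (b / c) f, hb, hf] with x h1 h2 h3
    rw [h1, Pi.smul_apply, h2, h3, smul_eq_mul]
    field_simp
  · rintro ⟨d, rfl⟩
    refine (mem_eigenSet_iff hα).2 ⟨fun x => d * c * v x, fun x => d * c * z x, ?_, ?_, ?_, ?_⟩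
    · simpa only [mul_left_comm] using h.const_mul (d * c)
    · simp only [hl, mul_zero]
    · simp only [hr, mul_zero]
    · filter_upwards [Lp.coeFn_smul d f, hf] with x h1 h3
      rw [h1, Pi.smul_apply, h3, smul_eq_mul, mul_assoc]

lemma exists_of_mem_eigenSet {α lam : ℝ} (hα : α < 1) {g : L2I} (hg : g ∈ eigenSet α lam) :
    ∃ a b, a * evenSol α lam 1 = 0 ∧ b * oddSol α lam 1 = 0 ∧
      g =ᵐ[muI] fun x => a * evenSol α lam x + b * oddSol α lam x := by
  obtain ⟨u, w, h, hl, hr, hgu⟩ := (mem_eigenSet_iff hα).1 hg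
  obtain ⟨a, b, hab⟩ := h.exists_eq_evenSol_add_oddSol hα
  have h1 := hab (-1) (by norm_num)
  have h2 := hab 1 (by norm_num)
  rw [hl, evenSol_neg, oddSol_neg] at h1
  rw [hr] at h2
  refine ⟨a, b, by linarith, by linarith, ?_⟩
  filter_upwards [hgu, ae_muI_mem_Ioo_ne_zero] with x h3 h4
  rw [h3, hab x (Ioo_subset_Icc_self h4.1)]

lemma oddSol_one_eq_zero_iff {α : ℝ} (hα0 : 0 ≤ α) (hα : α < 1) {lam : ℝ} :
    oddSol α lam 1 = 0 ↔
      ∃ n : ℕ, lam = kappaAlpha α ^ 2 * besselZero (nuAlpha α) (n + 1) ^ 2 := by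
  have h2 : 2 - α ≠ 0 := by linarith
  rw [oddSol_one, besselEntire_eq_zero_iff
    ⟨by linarith [nuAlpha_pos hα], nuAlpha_le hα0 hα⟩ (nuAlpha_pos hα).ne']
  refine exists_congr fun n => ?_
  rw [kappaAlpha, div_eq_iff (by positivity)]
  constructor <;> rintro rfl <;> ring

lemma evenSol_one_eq_zero_iff {α : ℝ} (hα0 : 0 ≤ α) (hα : α < 1) {lam : ℝ} :
    evenSol α lam 1 = 0 ↔
      ∃ n : ℕ, lam = kappaAlpha α ^ 2 * besselZero (-nuAlpha α) (n + 1) ^ 2 := by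
  have h2 : 2 - α ≠ 0 := by linarith
  rw [evenSol_one, besselEntire_eq_zero_iff
    ⟨by linarith [nuAlpha_le hα0 hα], by linarith [nuAlpha_pos hα]⟩
    (neg_ne_zero.2 (nuAlpha_pos hα).ne')]
  refine exists_congr fun n => ?_
  rw [kappaAlpha, div_eq_iff (by positivity)]
  constructor <;> rintro rfl <;> ring

lemma evenSol_one_ne_zero {α lam : ℝ} (hα : α < 1) (h : oddSol α lam 1 = 0) :
    evenSol α lam 1 ≠ 0 := by
  rw [oddSol_one] at h
  rw [evenSol_one]
  exact besselEntire_neg_ne_zero (nuAlpha_pos hα) (nuAlpha_lt_one hα) h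

lemma eigenSet_eq_span_odd {α lam c : ℝ} (hα : α < 1) {f : L2I} (h1 : oddSol α lam 1 = 0)
    (hc : c ≠ 0) (hf : f =ᵐ[muI] fun x => c * oddSol α lam x) :
    eigenSet α lam = (Submodule.span ℝ {f} : Submodule ℝ L2I) := by
  refine eigenSet_eq_span hα (isFluxPair_oddSol lam hα) (by rw [oddSol_neg, h1, neg_zero]) h1 hc
    hf fun g hg => ?_
  obtain ⟨a, b, ha, -, hg⟩ := exists_of_mem_eigenSet hα hg
  obtain rfl : a = 0 := by simpa [evenSol_one_ne_zero hα h1] using ha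
  exact ⟨b, by simpa using hg⟩

lemma eigenSet_eq_span_even {α lam c : ℝ} (hα : α < 1) {f : L2I} (h1 : evenSol α lam 1 = 0)
    (hc : c ≠ 0) (hf : f =ᵐ[muI] fun x => c * evenSol α lam x) :
    eigenSet α lam = (Submodule.span ℝ {f} : Submodule ℝ L2I) := by
  refine eigenSet_eq_span hα (isFluxPair_evenSol lam hα) (by rw [evenSol_neg, h1]) h1 hc
    hf fun g hg => ?_
  obtain ⟨a, b, -, hb, hg⟩ := exists_of_mem_eigenSet hα hg
  obtain rfl : b = 0 := by
    refine (mul_eq_zero.1 hb).resolve_right fun h => evenSol_one_ne_zero hα h h1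
  exact ⟨a, by simpa using hg⟩

lemma ne_zero_of_ae_eq_oddSol {α lam c : ℝ} (hα : α < 1) {f : L2I} (hc : c ≠ 0)
    (hf : f =ᵐ[muI] fun x => c * oddSol α lam x) : f ≠ 0 := by
  rintro rfl
  have h0 : oddSol α lam =ᵐ[muI] 0 := by
    filter_upwards [hf, Lp.coeFn_zero ℝ 2 muI] with x h1 h2
    rw [h2, Pi.zero_apply, eq_comm] at h1
    exact (mul_eq_zero.1 h1).resolve_left hc
  have := (isFluxPair_oddSol lam hα).flux_eq_zero hα h0 0 (by norm_num)
  rw [oddFlux, besselArg_zero lam hα] at this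
  exact (mul_pos (by linarith) (besselEntire_pos_of_nonpos (by linarith [nuAlpha_pos hα])
    le_rfl)).ne' this

lemma ne_zero_of_ae_eq_evenSol {α lam c : ℝ} (hα : α < 1) {f : L2I} (hc : c ≠ 0)
    (hf : f =ᵐ[muI] fun x => c * evenSol α lam x) : f ≠ 0 := by
  rintro rfl
  have h0 : evenSol α lam =ᵐ[muI] 0 := by
    filter_upwards [hf, Lp.coeFn_zero ℝ 2 muI] with x h1 h2
    rw [h2, Pi.zero_apply, eq_comm] at h1
    exact (mul_eq_zero.1 h1).resolve_left hc
  have := Measure.eqOn_open_of_ae_eq h0 isOpen_Ioo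
    ((isFluxPair_evenSol lam hα).continuousOn.mono Ioo_subset_Icc_self) continuousOn_const
    (by norm_num : (0 : ℝ) ∈ Ioo (-1) 1)
  rw [evenSol, besselArg_zero lam hα] at this
  exact (besselEntire_pos_of_nonpos (by linarith [nuAlpha_lt_one hα]) le_rfl).ne' this

lemma inner_eq_integral (f g : L2I) : inner ℝ f g = ∫ x, f x * g x ∂muI := by
  rw [L2.inner_def]
  refine integral_congr_ae (Eventually.of_forall fun x => ?_)
  simp [mul_comm]

lemma inner_eq_zero_of_mem_eigenSet {α lam mu : ℝ} (hα : α < 1) (hne : lam ≠ mu) {f g : L2I}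
    (hf : f ∈ eigenSet α lam) (hg : g ∈ eigenSet α mu) : inner ℝ f g = 0 := by
  obtain ⟨u, w, h, hl, hr, hfu⟩ := (mem_eigenSet_iff hα).1 hf
  obtain ⟨v, z, k, kl, kr, hgv⟩ := (mem_eigenSet_iff hα).1 hg
  have e1 := h.integral_mul_eq k kl kr
  have e2 := k.integral_mul_eq h hl hr
  have e3 : inner ℝ f g = ∫ x, u x * v x ∂muI := by
    rw [inner_eq_integral]
    refine integral_congr_ae ?_
    filter_upwards [hfu, hgv] with x h1 h2
    rw [h1, h2]
  simp only [mul_assoc] at e1 e2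
  rw [integral_const_mul] at e1 e2
  simp only [mul_comm (v _), mul_comm (z _)] at e2
  rw [← e1, ← e3] at e2
  have : (mu - lam) * inner ℝ f g = 0 := by linarith
  exact (mul_eq_zero.1 this).resolve_left (sub_ne_zero.2 hne.symm)

/-! ### The Bessel form of the eigenfunctions -/

lemma rpow_mul_besselJ_eq {α : ℝ} (hα : α < 1) (ν : ℝ) {j t : ℝ} (hj : 0 < j) (ht : 0 < t) :
    t ^ ((1 - α) / 2) * besselJ ν (j * t ^ kappaAlpha α) =
      (j / 2) ^ ν * (t ^ ((1 - α) / 2 + kappaAlpha α * ν) *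
        besselEntire ν (besselArg α (kappaAlpha α ^ 2 * j ^ 2) t)) := by
  have h2 : 2 - α ≠ 0 := by linarith
  have htk : 0 < t ^ kappaAlpha α := Real.rpow_pos_of_pos ht _
  have e1 : (j * t ^ kappaAlpha α / 2) ^ ν = (j / 2) ^ ν * t ^ (kappaAlpha α * ν) := by
    rw [mul_div_right_comm, Real.mul_rpow (by positivity) htk.le, ← Real.rpow_mul ht.le]
  have e2 : (j * t ^ kappaAlpha α / 2) ^ 2 = besselArg α (kappaAlpha α ^ 2 * j ^ 2) t := by
    have e3 : t ^ (2 - α) = (t ^ kappaAlpha α) ^ 2 := by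
      rw [← Real.rpow_two, ← Real.rpow_mul ht.le, kappaAlpha]
      congr 1
      ring
    rw [besselArg, abs_of_pos ht, e3]
    generalize t ^ kappaAlpha α = s
    rw [kappaAlpha]
    field_simp
  rw [besselJ_eq (by positivity), e1, e2, Real.rpow_add ht]
  ring

lemma kappaAlpha_mul_nuAlpha {α : ℝ} (hα : α < 1) :
    kappaAlpha α * nuAlpha α = (1 - α) / 2 := by
  rw [← two_sub_mul_nuAlpha hα, kappaAlpha]
  ring

lemma oddPhi_eq {α : ℝ} (hα : α < 1) {n : ℕ} (hj : 0 < besselZero (nuAlpha α) n) (x : ℝ) :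
    oddPhi α n x = (besselZero (nuAlpha α) n / 2) ^ nuAlpha α *
      oddSol α (kappaAlpha α ^ 2 * besselZero (nuAlpha α) n ^ 2) x := by
  have key : ∀ t : ℝ, 0 < t → t ^ ((1 - α) / 2) *
      besselJ (nuAlpha α) (besselZero (nuAlpha α) n * t ^ kappaAlpha α) =
      (besselZero (nuAlpha α) n / 2) ^ nuAlpha α *
        oddSol α (kappaAlpha α ^ 2 * besselZero (nuAlpha α) n ^ 2) t := by
    intro t ht
    rw [rpow_mul_besselJ_eq hα _ hj ht, kappaAlpha_mul_nuAlpha hα, add_halves, oddSol,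
      abs_of_pos ht, sub_eq_add_neg 1 α, Real.rpow_add ht, Real.rpow_one]
  rw [oddPhi]
  split_ifs with h1 h2
  · exact key x h1
  · rw [key |x| (abs_pos.2 h2.ne), abs_of_neg h2, oddSol_neg, mul_neg, neg_neg]
  · obtain rfl : x = 0 := by linarith
    simp [oddSol]

lemma evenPhi_eq {α : ℝ} (hα : α < 1) {n : ℕ} (hj : 0 < besselZero (-nuAlpha α) n) {x : ℝ}
    (hx : x ≠ 0) :
    evenPhi α n x = (besselZero (-nuAlpha α) n / 2) ^ (-nuAlpha α) *
      evenSol α (kappaAlpha α ^ 2 * besselZero (-nuAlpha α) n ^ 2) x := by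
  have key : ∀ t : ℝ, 0 < t → t ^ ((1 - α) / 2) *
      besselJ (-nuAlpha α) (besselZero (-nuAlpha α) n * t ^ kappaAlpha α) =
      (besselZero (-nuAlpha α) n / 2) ^ (-nuAlpha α) *
        evenSol α (kappaAlpha α ^ 2 * besselZero (-nuAlpha α) n ^ 2) t := by
    intro t ht
    rw [rpow_mul_besselJ_eq hα _ hj ht, mul_neg, kappaAlpha_mul_nuAlpha hα, add_neg_cancel,
      Real.rpow_zero, one_mul, evenSol]
  rw [evenPhi]
  split_ifs with h1 h2
  · exact key x h1
  · rw [key |x| (abs_pos.2 hx), abs_of_neg h2, evenSol_neg]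
  · exact absurd (le_antisymm (not_lt.1 h1) (not_lt.1 h2)) hx

lemma odd_oddPhi (α : ℝ) (n : ℕ) : Function.Odd (oddPhi α n) := by
  intro x
  rcases lt_trichotomy x 0 with h | rfl | h
  · have h1 : ¬ 0 < x := not_lt.2 h.le
    simp [oddPhi, h, h1, abs_of_neg h]
  · simp [oddPhi]
  · have h1 : ¬ x < 0 := not_lt.2 h.le
    simp [oddPhi, h, h1, abs_of_pos h]

lemma even_evenPhi (α : ℝ) (n : ℕ) : Function.Even (evenPhi α n) := by
  intro x
  rcases lt_trichotomy x 0 with h | rfl | h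
  · have h1 : ¬ 0 < x := not_lt.2 h.le
    simp [evenPhi, h, h1, abs_of_neg h]
  · simp
  · have h1 : ¬ x < 0 := not_lt.2 h.le
    simp [evenPhi, h, h1, abs_of_pos h]

/-! ### The solution operator of the problem with right hand side -/

/-- The constant for which the flux `greenFlux α f` gives a function vanishing at both end
points. -/
noncomputable def fluxConst (α : ℝ) (f : ℝ → ℝ) : ℝ :=
  (∫ s in (-1 : ℝ)..1, |s| ^ (-α) * ∫ t in (-1 : ℝ)..s, f t) / ∫ s in (-1 : ℝ)..1, |s| ^ (-α)

/-- The flux of the solution of `-(|x|^α u')' = f` with zero boundary values. -/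
noncomputable def greenFlux (α : ℝ) (f : ℝ → ℝ) (x : ℝ) : ℝ :=
  fluxConst α f - ∫ t in (-1 : ℝ)..x, f t

/-- The solution of `-(|x|^α u')' = f` with zero boundary values. -/
noncomputable def greenSol (α : ℝ) (f : ℝ → ℝ) (x : ℝ) : ℝ :=
  ∫ s in (-1 : ℝ)..x, |s| ^ (-α) * greenFlux α f s

lemma integral_abs_rpow_neg_pos {α : ℝ} (hα0 : 0 ≤ α) (hα : α < 1) :
    0 < ∫ s in (-1 : ℝ)..1, |s| ^ (-α) := by
  have h : ∫ _ in (-1 : ℝ)..1, (1 : ℝ) ≤ ∫ s in (-1 : ℝ)..1, |s| ^ (-α) := by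
    refine intervalIntegral.integral_mono_ae_restrict (by norm_num) (by simp)
      (intervalIntegrable_abs_rpow_neg hα _ _) ?_
    rw [← muI_eq_restrict_Icc]
    filter_upwards [ae_muI_mem_Ioo_ne_zero] with x hx
    exact Real.one_le_rpow_of_pos_of_le_one_of_nonpos (abs_pos.2 hx.2)
      (abs_le.2 ⟨hx.1.1.le, hx.1.2.le⟩) (by linarith)
  refine lt_of_lt_of_le ?_ h
  norm_num

lemma L2I.intervalIntegrable (f : L2I) : IntervalIntegrable f volume (-1) 1 := by
  rw [intervalIntegrable_iff, IntegrableOn, ← muI_eq_restrict_uIoc]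
  exact (Lp.memLp f).integrable (by norm_num)

lemma continuousOn_primitive_Icc {f : ℝ → ℝ} (hf : IntervalIntegrable f volume (-1) 1) :
    ContinuousOn (fun x => ∫ t in (-1 : ℝ)..x, f t) (uIcc (-1) 1) :=
  (hf.absolutelyContinuousOnInterval_intervalIntegral left_mem_uIcc).continuousOn

lemma continuousOn_greenFlux (α : ℝ) {f : ℝ → ℝ} (hf : IntervalIntegrable f volume (-1) 1) :
    ContinuousOn (greenFlux α f) (uIcc (-1) 1) :=
  continuousOn_const.sub (continuousOn_primitive_Icc hf)

lemma isFluxPair_greenSol {α : ℝ} (hα : α < 1) {f : ℝ → ℝ}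
    (hf : IntervalIntegrable f volume (-1) 1) :
    IsFluxPair α f (greenSol α f) (greenFlux α f) := by
  have hw := continuousOn_greenFlux α hf
  have hρw := (intervalIntegrable_abs_rpow_neg hα (-1) 1).mul_continuousOn hw
  have hc : AbsolutelyContinuousOnInterval (fun _ : ℝ => fluxConst α f) (-1) 1 :=
    contDiffOn_const.absolutelyContinuousOnInterval
  refine ⟨hρw.absolutelyContinuousOnInterval_intervalIntegral left_mem_uIcc,
    hc.sub (hf.absolutelyContinuousOnInterval_intervalIntegral left_mem_uIcc), ?_, ?_⟩
  · refine ae_muI_iff.2 ?_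
    filter_upwards [hρw.ae_hasDerivAt_integral] with x hx hx'
    exact (hx hx' (-1) left_mem_uIcc).deriv
  · refine ae_muI_iff.2 ?_
    filter_upwards [hf.ae_hasDerivAt_integral] with x hx hx'
    exact ((hx hx' (-1) left_mem_uIcc).const_sub (fluxConst α f)).deriv

lemma greenSol_left (α : ℝ) (f : ℝ → ℝ) : greenSol α f (-1) = 0 :=
  intervalIntegral.integral_same

lemma greenSol_right {α : ℝ} (hα0 : 0 ≤ α) (hα : α < 1) {f : ℝ → ℝ}
    (hf : IntervalIntegrable f volume (-1) 1) : greenSol α f 1 = 0 := by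
  have h1 := intervalIntegrable_abs_rpow_neg hα (-1) 1
  have h2 := h1.mul_continuousOn (continuousOn_primitive_Icc hf)
  simp only [greenSol, greenFlux, mul_sub]
  rw [intervalIntegral.integral_sub (h1.mul_const _) h2, intervalIntegral.integral_mul_const,
    fluxConst, mul_div_cancel₀ _ (integral_abs_rpow_neg_pos hα0 hα).ne', sub_self]

/-- On the unit ball of `L²`, the fluxes of the solutions are uniformly bounded. -/
lemma abs_greenFlux_le {α : ℝ} (hα0 : 0 ≤ α) (hα : α < 1) {f : L2I} (hf : ‖f‖ ≤ 1) {x : ℝ}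
    (hx : x ∈ Icc (-1 : ℝ) 1) : |greenFlux α f x| ≤ 3 := by
  have hfi := L2I.intervalIntegrable f
  have hsq : Integrable (fun x => f x ^ 2) muI := (Lp.memLp f).integrable_sq
  have hnorm : ∫ x, f x ^ 2 ∂muI ≤ 1 := by
    have h := inner_eq_integral f f
    rw [real_inner_self_eq_norm_sq] at h
    simp only [← sq] at h
    rw [← h]
    exact pow_le_one₀ (norm_nonneg f) hf
  -- `|f| ≤ (1 + f²) / 2`, and the right hand side has integral at most `(2 + 1) / 2`
  have hprim : ∀ y ∈ Icc (-1 : ℝ) 1, |∫ t in (-1 : ℝ)..y, f t| ≤ 3 / 2 := by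
    intro y hy
    have hint : Integrable (fun t => (1 + f t ^ 2) / 2) muI :=
      ((integrable_const 1).add hsq).div_const 2
    have hsub : Ioc (-1) y ⊆ Ioc (-1 : ℝ) 1 := Ioc_subset_Ioc_right hy.2
    have hle : ∀ t, |f t| ≤ (1 + f t ^ 2) / 2 := fun t => by
      nlinarith [sq_abs (f t), sq_nonneg (|f t| - 1)]
    calc |∫ t in (-1 : ℝ)..y, f t| ≤ ∫ t in Ioc (-1 : ℝ) y, |f t| := by
          rw [intervalIntegral.integral_of_le hy.1, ← Real.norm_eq_abs]
          exact norm_integral_le_integral_norm _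
      _ ≤ ∫ t in Ioc (-1 : ℝ) 1, |f t| := by
          refine setIntegral_mono_set ?_ (Eventually.of_forall fun t => abs_nonneg _)
            hsub.eventuallyLE
          exact ((intervalIntegrable_iff_integrableOn_Ioc_of_le (by norm_num)).1 hfi).abs
      _ = ∫ t, |f t| ∂muI := by
          rw [← intervalIntegral.integral_of_le (by norm_num), intervalIntegral_eq_integral_muI]
      _ ≤ ∫ t, (1 + f t ^ 2) / 2 ∂muI :=
          integral_mono ((Lp.memLp f).integrable (by norm_num)).abs hint hle
      _ ≤ 3 / 2 := by
          rw [integral_div, integral_add (integrable_const 1) hsq]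
          have : ∫ _, (1 : ℝ) ∂muI = 2 := by
            rw [← intervalIntegral_eq_integral_muI]
            norm_num
          linarith
  have hconst : |fluxConst α f| ≤ 3 / 2 := by
    have hρ := integral_abs_rpow_neg_pos hα0 hα
    rw [fluxConst, abs_div, abs_of_pos hρ, div_le_iff₀ hρ, ← intervalIntegral.integral_const_mul,
      ← Real.norm_eq_abs]
    refine intervalIntegral.norm_integral_le_of_norm_le (by norm_num) ?_
      ((intervalIntegrable_abs_rpow_neg hα _ _).const_mul _)
    refine Eventually.of_forall fun t ht => ?_
    rw [Real.norm_eq_abs, abs_mul, abs_of_nonneg (Real.rpow_nonneg (abs_nonneg t) _), mul_comm]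
    exact mul_le_mul_of_nonneg_right (hprim t (Ioc_subset_Icc_self ht))
      (Real.rpow_nonneg (abs_nonneg t) _)
  have := abs_sub (fluxConst α f) (∫ t in (-1 : ℝ)..x, f t)
  have := hprim x hx
  rw [greenFlux]
  linarith

lemma abs_greenSol_sub_le {α : ℝ} (hα0 : 0 ≤ α) (hα : α < 1) {f : L2I} (hf : ‖f‖ ≤ 1) {x y : ℝ}
    (hx : x ∈ Icc (-1 : ℝ) 1) (hy : y ∈ Icc (-1 : ℝ) 1) :
    |greenSol α f x - greenSol α f y| ≤ |3 * ∫ s in y..x, |s| ^ (-α)| := by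
  have h := isFluxPair_greenSol hα (L2I.intervalIntegrable f)
  have hm : (-1 : ℝ) ∈ Icc (-1 : ℝ) 1 := by norm_num
  rw [greenSol, greenSol, intervalIntegral.integral_interval_sub_left
    (h.intervalIntegrable hα hm hx) (h.intervalIntegrable hα hm hy),
    ← intervalIntegral.integral_const_mul, ← Real.norm_eq_abs]
  refine intervalIntegral.norm_integral_le_abs_of_norm_le ?_
    ((intervalIntegrable_abs_rpow_neg hα _ _).const_mul _)
  refine (ae_restrict_mem measurableSet_uIoc).mono fun t ht => ?_
  rw [Real.norm_eq_abs, abs_mul, abs_of_nonneg (Real.rpow_nonneg (abs_nonneg t) _), mul_comm]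
  exact mul_le_mul_of_nonneg_right
    (abs_greenFlux_le hα0 hα hf (uIcc_subset_Icc hy hx (uIoc_subset_uIcc ht)))
    (Real.rpow_nonneg (abs_nonneg t) _)

/-- The map `f ↦ greenSol α f` on `L²(-1, 1)`. -/
noncomputable def greenFun {α : ℝ} (hα : α < 1) (f : L2I) : L2I :=
  (isFluxPair_greenSol hα (L2I.intervalIntegrable f)).memLp.toLp

lemma coeFn_greenFun {α : ℝ} (hα : α < 1) (f : L2I) : greenFun hα f =ᵐ[muI] greenSol α f :=
  MemLp.coeFn_toLp _

/-- Both sides are `∫ |x|^(-α) w z`, where `w` and `z` are the fluxes of the two solutions. -/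
lemma inner_greenFun {α : ℝ} (hα0 : 0 ≤ α) (hα : α < 1) (f g : L2I) :
    inner ℝ (greenFun hα f) g = inner ℝ f (greenFun hα g) := by
  have hf := isFluxPair_greenSol hα (L2I.intervalIntegrable f)
  have hg := isFluxPair_greenSol hα (L2I.intervalIntegrable g)
  have e1 := hf.integral_mul_eq hg (greenSol_left α g)
    (greenSol_right hα0 hα (L2I.intervalIntegrable g))
  have e2 := hg.integral_mul_eq hf (greenSol_left α f)
    (greenSol_right hα0 hα (L2I.intervalIntegrable f))
  have i1 : inner ℝ (greenFun hα f) g = ∫ x, g x * greenSol α f x ∂muI := by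
    rw [inner_eq_integral]
    refine integral_congr_ae ?_
    filter_upwards [coeFn_greenFun hα f] with x hx
    rw [hx, mul_comm]
  have i2 : inner ℝ f (greenFun hα g) = ∫ x, f x * greenSol α g x ∂muI := by
    rw [inner_eq_integral]
    refine integral_congr_ae ?_
    filter_upwards [coeFn_greenFun hα g] with x hx
    rw [hx]
  rw [i1, i2, e1, e2]
  simp only [mul_comm (greenFlux α g _)]

/-- The solution operator; its linearity follows from its symmetry. -/
noncomputable def greenLin {α : ℝ} (hα0 : 0 ≤ α) (hα : α < 1) : L2I →ₗ[ℝ] L2I where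
  toFun := greenFun hα
  map_add' f g := by
    refine ext_inner_right ℝ fun h => ?_
    rw [inner_add_left, inner_greenFun hα0, inner_greenFun hα0, inner_greenFun hα0,
      inner_add_left]
  map_smul' c f := by
    refine ext_inner_right ℝ fun h => ?_
    rw [RingHom.id_apply, inner_smul_left, inner_greenFun hα0, inner_greenFun hα0,
      inner_smul_left]

/-- Compactness of the solution operator, by the theorem of Arzelà and Ascoli: the solutions with
right hand side in the unit ball are equicontinuous, with the modulus of continuity of a primitive
of `|x|^(-α)`. -/
lemma isCompactOperator_greenLin {α : ℝ} (hα0 : 0 ≤ α) (hα : α < 1) :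
    IsCompactOperator (greenLin hα0 hα) := by
  have hρ := fun a b => intervalIntegrable_abs_rpow_neg hα a b
  set M : ℝ := 3 * ∫ s in (-1 : ℝ)..1, |s| ^ (-α) with hM
  let A : Set (BoundedContinuousFunction (Icc (-1 : ℝ) 1) ℝ) :=
    {φ | (∀ x, φ x ∈ Icc (-M) M) ∧ ∀ x y, |φ x - φ y| ≤ |3 * ∫ s in (y : ℝ)..x, |s| ^ (-α)|}
  have hA : IsCompact (closure A) := by
    refine BoundedContinuousFunction.arzela_ascoli (Icc (-M) M) isCompact_Icc A
      (fun φ x hφ => hφ.1 x) fun x₀ => ?_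
    refine Metric.equicontinuousAt_iff_right.2 fun ε hε => ?_
    have hcont : Continuous fun x : Icc (-1 : ℝ) 1 => |3 * ∫ s in (x : ℝ)..x₀, |s| ^ (-α)| := by
      have h1 : Continuous fun x : ℝ => ∫ s in (x₀ : ℝ)..x, |s| ^ (-α) :=
        intervalIntegral.continuous_primitive hρ x₀
      have h2 : (fun x : Icc (-1 : ℝ) 1 => |3 * ∫ s in (x : ℝ)..x₀, |s| ^ (-α)|) =
          fun x : Icc (-1 : ℝ) 1 => |3 * -∫ s in (x₀ : ℝ)..x, |s| ^ (-α)| := by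
        funext x
        rw [intervalIntegral.integral_symm]
      rw [h2]
      exact ((h1.comp continuous_subtype_val).neg.const_mul 3).abs
    have h0 := (hcont.tendsto x₀).eventually_lt_const (u := ε) (by simpa using hε)
    filter_upwards [h0] with x hx φ
    exact (φ.2.2 x₀ x).trans_lt hx
  let p : C(ℝ, Icc (-1 : ℝ) 1) := ⟨projIcc (-1) 1 (by norm_num), continuous_projIcc⟩
  let J : BoundedContinuousFunction (Icc (-1 : ℝ) 1) ℝ → L2I := fun φ =>
    BoundedContinuousFunction.toLp 2 muI ℝ (φ.compContinuous p)
  have hJ : Continuous J := (BoundedContinuousFunction.toLp 2 muI ℝ).continuous.comp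
    (BoundedContinuousFunction.continuous_compContinuous p)
  refine ⟨J '' closure A, hA.image hJ, ?_⟩
  filter_upwards [Metric.closedBall_mem_nhds (0 : L2I) one_pos] with f hf
  have hf1 : ‖f‖ ≤ 1 := by simpa using hf
  have hpair := isFluxPair_greenSol hα (L2I.intervalIntegrable f)
  refine ⟨BoundedContinuousFunction.mkOfCompact
    ⟨fun x : Icc (-1 : ℝ) 1 => greenSol α f x, hpair.continuousOn.domRestrict⟩,
    subset_closure ⟨fun x => ?_, fun x y => ?_⟩, ?_⟩
  · have h1 := abs_greenSol_sub_le hα0 hα hf1 x.2 (by norm_num : (-1 : ℝ) ∈ Icc (-1 : ℝ) 1)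
    have hnn : ∀ a b : ℝ, a ≤ b → 0 ≤ ∫ s in a..b, |s| ^ (-α) := fun a b hab =>
      intervalIntegral.integral_nonneg hab fun s _ => Real.rpow_nonneg (abs_nonneg s) _
    have h2 : ∫ s in (-1 : ℝ)..x, |s| ^ (-α) ≤ ∫ s in (-1 : ℝ)..1, |s| ^ (-α) := by
      rw [← intervalIntegral.integral_add_adjacent_intervals (hρ (-1) x) (hρ x 1)]
      linarith [hnn x 1 x.2.2]
    rw [greenSol_left, sub_zero, abs_of_nonneg (mul_nonneg (by norm_num) (hnn _ _ x.2.1))] at h1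
    exact abs_le.1 (h1.trans (by rw [hM]; linarith))
  · exact abs_greenSol_sub_le hα0 hα hf1 x.2 y.2
  · refine Lp.ext ?_
    filter_upwards [BoundedContinuousFunction.coeFn_toLp 2 muI ℝ
      ((BoundedContinuousFunction.mkOfCompact
      ⟨fun x : Icc (-1 : ℝ) 1 => greenSol α f x, hpair.continuousOn.domRestrict⟩).compContinuous p),
      coeFn_greenFun hα f, ae_muI_mem_Ioo_ne_zero] with x h1 h2 h3
    refine h1.trans (Eq.trans ?_ h2.symm)
    change greenSol α f (projIcc (-1 : ℝ) 1 (by norm_num) x) = greenSol α f x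
    rw [projIcc_of_mem _ (Ioo_subset_Icc_self h3.1)]

lemma eq_zero_of_greenFun_eq_zero {α : ℝ} (hα : α < 1) {f : L2I} (hf : greenFun hα f = 0) :
    f = 0 := by
  have h := isFluxPair_greenSol hα (L2I.intervalIntegrable f)
  have hu : greenSol α f =ᵐ[muI] 0 := by
    have := coeFn_greenFun hα f
    rw [hf] at this
    exact this.symm.trans (Lp.coeFn_zero ℝ 2 muI)
  have hw := h.flux_eq_zero hα hu
  refine Lp.ext ?_
  filter_upwards [h.deriv_flux_eq, ae_muI_mem_Ioo_ne_zero, Lp.coeFn_zero ℝ 2 muI] with x h1 h2 h3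
  have hev : greenFlux α f =ᶠ[𝓝 x] fun _ => 0 := by
    filter_upwards [Ioo_mem_nhds h2.1.1 h2.1.2] with y hy
    exact hw y hy
  rw [hev.deriv_eq, deriv_const] at h1
  rw [h3, Pi.zero_apply]
  linarith

lemma mem_eigenSet_of_greenFun_eq {α mu : ℝ} (hα0 : 0 ≤ α) (hα : α < 1) (hmu : mu ≠ 0) {f : L2I}
    (hf : greenFun hα f = mu • f) : f ∈ eigenSet α mu⁻¹ := by
  have h := isFluxPair_greenSol hα (L2I.intervalIntegrable f)
  have hfu : f =ᵐ[muI] fun x => mu⁻¹ * greenSol α f x := by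
    have h1 := coeFn_greenFun hα f
    rw [hf] at h1
    filter_upwards [h1, Lp.coeFn_smul mu f] with x h1 h2
    rw [← h1, h2, Pi.smul_apply, smul_eq_mul, inv_mul_cancel_left₀ hmu]
  refine (mem_eigenSet_iff hα).2 ⟨_, _, (h.const_mul mu⁻¹).congr_right ?_, ?_, ?_, hfu⟩
  · filter_upwards [hfu] with x hx
    rw [hx]
  · rw [greenSol_left, mul_zero]
  · rw [greenSol_right hα0 hα (L2I.intervalIntegrable f), mul_zero]

/-- Completeness of the eigenfunctions, by the spectral theorem for the solution operator. -/
theorem topologicalClosure_eq_top_of_eigenSet_subset {α : ℝ} (hα0 : 0 ≤ α) (hα : α < 1)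
    {S : Submodule ℝ L2I} (hS : ∀ lam, eigenSet α lam ⊆ S) : S.topologicalClosure = ⊤ := by
  have hcomp := isCompactOperator_greenLin hα0 hα
  let T : L2I →L[ℝ] L2I := ⟨greenLin hα0 hα, hcomp.continuous⟩
  have key := ContinuousLinearMap.orthogonalComplement_iSup_eigenspaces_eq_bot (T := T) hcomp
    fun f g => inner_greenFun hα0 hα f g
  rw [Submodule.topologicalClosure_eq_top_iff, eq_bot_iff, ← key]
  refine Submodule.orthogonal_le (iSup_le fun mu f hf => ?_)
  have hf' : greenFun hα f = mu • f := Module.End.mem_eigenspace_iff.1 hf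
  by_cases hmu : mu = 0
  · rw [hmu, zero_smul] at hf'
    rw [eq_zero_of_greenFun_eq_zero hα hf']
    exact S.zero_mem
  · exact hS _ (mem_eigenSet_of_greenFun_eq hα0 hα hmu hf')

/-! ### The eigenvalues and the orthogonal basis -/

lemma isEigenvalue_of_eigenSet_eq_span {α lam : ℝ} {f : L2I}
    (h : eigenSet α lam = (Submodule.span ℝ {f} : Submodule ℝ L2I)) (hf : f ≠ 0) :
    IsEigenvalue α lam :=
  ⟨f, by rw [h]; exact Submodule.mem_span_singleton_self f, hf⟩

/-- A nonzero solution forces the odd or the even explicit solution to vanish at `1`. -/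
lemma IsEigenvalue.oddSol_or_evenSol {α lam : ℝ} (hα : α < 1) (h : IsEigenvalue α lam) :
    oddSol α lam 1 = 0 ∨ evenSol α lam 1 = 0 := by
  obtain ⟨f, hf, hf0⟩ := h
  by_contra! hne
  obtain ⟨a, b, ha, hb, hab⟩ := exists_of_mem_eigenSet hα hf
  obtain rfl : a = 0 := (mul_eq_zero.1 ha).resolve_right hne.2
  obtain rfl : b = 0 := (mul_eq_zero.1 hb).resolve_right hne.1
  refine hf0 (Lp.ext ?_)
  filter_upwards [hab, Lp.coeFn_zero ℝ 2 muI] with x h1 h2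
  rw [h1, h2]
  simp

lemma exists_one_le_iff_exists_succ {p : ℕ → Prop} :
    (∃ n : ℕ, 1 ≤ n ∧ p n) ↔ ∃ n : ℕ, p (n + 1) := by
  constructor
  · rintro ⟨n, hn, hp⟩
    exact ⟨n - 1, by rwa [Nat.sub_add_cancel hn]⟩
  · rintro ⟨n, hp⟩
    exact ⟨n + 1, Nat.le_add_left 1 n, hp⟩

theorem mainTheorem4 (α : ℝ) (hα0 : 0 ≤ α) (hα1 : α < 1) :
    -- the sequences `j_{ν,n}`, `j_{-ν,n}` (`n ≥ 1`) strictly increase through all positive zeros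
    (∀ ν ∈ ({nuAlpha α, -nuAlpha α} : Set ℝ),
      StrictMono (fun n : ℕ => besselZero ν (n + 1)) ∧
      Set.range (fun n : ℕ => besselZero ν (n + 1)) = besselZeroSet ν) ∧
    -- the eigenvalues are exactly the members of the two families
    (∀ lam : ℝ, IsEigenvalue α lam ↔
      (∃ n : ℕ, 1 ≤ n ∧ lam = kappaAlpha α ^ 2 * besselZero (nuAlpha α) n ^ 2) ∨
      (∃ n : ℕ, 1 ≤ n ∧ lam = kappaAlpha α ^ 2 * besselZero (-nuAlpha α) n ^ 2)) ∧
    -- the symmetry of the two families of functions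
    (∀ n : ℕ, 1 ≤ n → Function.Odd (oddPhi α n) ∧ Function.Even (evenPhi α n)) ∧
    -- the functions define elements of `L²(-1, 1)` which span the eigenspaces and together form
    -- an orthogonal basis
    ∃ o e : ℕ → L2I,
      (∀ n : ℕ, o n =ᵐ[muI] oddPhi α (n + 1)) ∧
      (∀ n : ℕ, e n =ᵐ[muI] evenPhi α (n + 1)) ∧
      (∀ n : ℕ, eigenSet α (kappaAlpha α ^ 2 * besselZero (nuAlpha α) (n + 1) ^ 2) =
        (Submodule.span ℝ {o n} : Submodule ℝ L2I)) ∧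
      (∀ n : ℕ, eigenSet α (kappaAlpha α ^ 2 * besselZero (-nuAlpha α) (n + 1) ^ 2) =
        (Submodule.span ℝ {e n} : Submodule ℝ L2I)) ∧
      IsOrthogonalBasis (Sum.elim o e) := by
  have hν0 := nuAlpha_pos hα1
  have hν1 := nuAlpha_le hα0 hα1
  have hp : nuAlpha α ∈ Icc (-1 / 2 : ℝ) (1 / 2) := ⟨by linarith, hν1⟩
  have hm : -nuAlpha α ∈ Icc (-1 / 2 : ℝ) (1 / 2) := ⟨by linarith, by linarith⟩
  have hp0 : nuAlpha α ≠ 0 := hν0.ne'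
  have hm0 : -nuAlpha α ≠ 0 := neg_ne_zero.2 hp0
  have hjo := besselZero_succ_pos hp hp0
  have hje := besselZero_succ_pos hm hm0
  let lamO : ℕ → ℝ := fun n => kappaAlpha α ^ 2 * besselZero (nuAlpha α) (n + 1) ^ 2
  let lamE : ℕ → ℝ := fun n => kappaAlpha α ^ 2 * besselZero (-nuAlpha α) (n + 1) ^ 2
  have hO : ∀ n, oddSol α (lamO n) 1 = 0 := fun n => (oddSol_one_eq_zero_iff hα0 hα1).2 ⟨n, rfl⟩
  have hE : ∀ n, evenSol α (lamE n) 1 = 0 := fun n => (evenSol_one_eq_zero_iff hα0 hα1).2 ⟨n, rfl⟩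
  -- the factors between the Bessel form of the eigenfunctions and the explicit solutions
  let co : ℕ → ℝ := fun n => (besselZero (nuAlpha α) (n + 1) / 2) ^ nuAlpha α
  let ce : ℕ → ℝ := fun n => (besselZero (-nuAlpha α) (n + 1) / 2) ^ (-nuAlpha α)
  have hco : ∀ n, co n ≠ 0 := fun n => (Real.rpow_pos_of_pos (half_pos (hjo n)) _).ne'
  have hce : ∀ n, ce n ≠ 0 := fun n => (Real.rpow_pos_of_pos (half_pos (hje n)) _).ne'
  let o : ℕ → L2I := fun n =>
    ((isFluxPair_oddSol (lamO n) hα1).memLp.const_mul (co n)).toLp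
  let e : ℕ → L2I := fun n =>
    ((isFluxPair_evenSol (lamE n) hα1).memLp.const_mul (ce n)).toLp
  have ho : ∀ n, o n =ᵐ[muI] fun x => co n * oddSol α (lamO n) x := fun n => MemLp.coeFn_toLp _
  have he : ∀ n, e n =ᵐ[muI] fun x => ce n * evenSol α (lamE n) x := fun n => MemLp.coeFn_toLp _
  have hspo := fun n => eigenSet_eq_span_odd hα1 (hO n) (hco n) (ho n)
  have hspe := fun n => eigenSet_eq_span_even hα1 (hE n) (hce n) (he n)
  have ho0 := fun n => ne_zero_of_ae_eq_oddSol hα1 (hco n) (ho n)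
  have he0 := fun n => ne_zero_of_ae_eq_evenSol hα1 (hce n) (he n)
  have hmo : ∀ n, o n ∈ eigenSet α (lamO n) := fun n => by
    rw [hspo]; exact Submodule.mem_span_singleton_self _
  have hme : ∀ n, e n ∈ eigenSet α (lamE n) := fun n => by
    rw [hspe]; exact Submodule.mem_span_singleton_self _
  have heig : ∀ lam, IsEigenvalue α lam ↔ (∃ n, lam = lamO n) ∨ ∃ n, lam = lamE n := by
    intro lam
    constructor
    · intro h
      exact (h.oddSol_or_evenSol hα1).imp (oddSol_one_eq_zero_iff hα0 hα1).1
        (evenSol_one_eq_zero_iff hα0 hα1).1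
    · rintro (⟨n, rfl⟩ | ⟨n, rfl⟩)
      · exact isEigenvalue_of_eigenSet_eq_span (hspo n) (ho0 n)
      · exact isEigenvalue_of_eigenSet_eq_span (hspe n) (he0 n)
  have hκ : kappaAlpha α ^ 2 ≠ 0 := by
    have : 0 < kappaAlpha α := div_pos (by linarith) two_pos
    positivity
  have hinjo : Function.Injective lamO := fun i k hik => by
    have h := (pow_left_inj₀ (hjo i).le (hjo k).le two_ne_zero).1 (mul_left_cancel₀ hκ hik)
    exact Nat.succ_injective ((strictMono_besselZero hp hp0).injective h)
  have hinje : Function.Injective lamE := fun i k hik => by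
    have h := (pow_left_inj₀ (hje i).le (hje k).le two_ne_zero).1 (mul_left_cancel₀ hκ hik)
    exact Nat.succ_injective ((strictMono_besselZero hm hm0).injective h)
  have hoe : ∀ i k, lamO i ≠ lamE k := fun i k hik =>
    evenSol_one_ne_zero hα1 (hO i) (by rw [hik]; exact hE k)
  refine ⟨?_, fun lam => ?_, fun n _ => ⟨odd_oddPhi α n, even_evenPhi α n⟩, o, e, fun n => ?_,
    fun n => ?_, hspo, hspe, ?_, ?_, ?_⟩
  · rintro ν (rfl | rfl)
    · exact ⟨(strictMono_besselZero hp hp0).comp (strictMono_id.add_const 1),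
        range_besselZero_succ hp hp0⟩
    · exact ⟨(strictMono_besselZero hm hm0).comp (strictMono_id.add_const 1),
        range_besselZero_succ hm hm0⟩
  · rw [heig, exists_one_le_iff_exists_succ, exists_one_le_iff_exists_succ]
  · filter_upwards [ho n] with x hx
    rw [hx, oddPhi_eq hα1 (hjo n)]
  · filter_upwards [he n, ae_muI_mem_Ioo_ne_zero] with x hx hx'
    rw [hx, evenPhi_eq hα1 (hje n) hx'.2]
  · rintro (n | n)
    · exact ho0 n
    · exact he0 n
  · rintro (i | i) (k | k) hik
    · exact inner_eq_zero_of_mem_eigenSet hα1 (fun h => hik (by rw [hinjo h])) (hmo i) (hmo k)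
    · exact inner_eq_zero_of_mem_eigenSet hα1 (hoe i k) (hmo i) (hme k)
    · exact inner_eq_zero_of_mem_eigenSet hα1 (hoe k i).symm (hme i) (hmo k)
    · exact inner_eq_zero_of_mem_eigenSet hα1 (fun h => hik (by rw [hinje h])) (hme i) (hme k)
  · refine topologicalClosure_eq_top_of_eigenSet_subset hα0 hα1 fun lam g hg => ?_
    by_cases hg0 : g = 0
    · rw [hg0]
      exact Submodule.zero_mem _
    rcases (heig lam).1 ⟨g, hg, hg0⟩ with ⟨n, rfl⟩ | ⟨n, rfl⟩
    · rw [hspo] at hg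
      exact Submodule.span_mono (t := range (Sum.elim o e))
        (singleton_subset_iff.2 ⟨Sum.inl n, rfl⟩) hg
    · rw [hspe] at hg
      exact Submodule.span_mono (t := range (Sum.elim o e))
        (singleton_subset_iff.2 ⟨Sum.inr n, rfl⟩) hg
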